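/- Let $X=[0,1]^2$ and $S=\{(p_1,p_2): p_1,p_2\ge 0,\ p_1+p_2=1\}$. A buyer's type $x=(x_1,x_2)$ consists of two independent values, each uniform on $[0,1]$; an allocation $s\in S$ is worth $s\cdot x$ to type $x$. A mechanism $(s,p)$ assigns to each type $x\in X$ an allocation $s(x)\in S$ and a payment $p(x)\in\mathbb R$; its utility is $u(x)=s(x)\cdot x-p(x)$. It is admissible if it is incentive compatible ($u(x)\ge s(y)\cdot x-p(y)$ for all $x,y\in X$) and individually rational ($u(x)\ge 0$ for all $x\in X$); its revenue is $E[p(x)]$. Let $U(X,S)$ be the set of convex $u:X\to\mathbb R$ that have at every point of $X$ a subgradient (relative to $X$) in $S$, and let $\ell_S(x,y)=\sup_{s\in S}s\cdot(x-y)$. Let $\mu$ be the signed measure on $X$ consisting of a point mass $+1$ at the origin, mass $+1$ uniformly distributed on each of the segments from $(1,0)$ to $(1,1)$ and from $(0,1)$ to $(1,1)$, and mass $-3$ uniformly distributed on the square. For signed measures write $\nu'\succeq_{X,S}\nu$ if $\int u\,d\nu'\ge\int u\,d\nu$ for all $u\in U(X,S)$. Put $u^*(x)=\max(x_1-\tfrac13,\,x_2)$.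 1. There is a mechanism that gives each type in $X$ a most preferred option of the menu "item 1 at price $1/3$, or item 2 for free". Every such mechanism (however ties are broken) is admissible and has maximal revenue among all admissible mechanisms (every admissible mechanism has an integrable payment); its utility on $X$ is $u^*$, and its revenue equals $\int u^*\,d\mu$. 2. $u^*\in U(X,S)$, and $\int u\,d\mu\le\int u^*\,d\mu$ for all $u\in U(X,S)$. 3. The set of $x\in X$ at which $(1,0)$ is a subgradient of $u^*$ (relative to $X$) is $\{x\in X: x_1\ge x_2+\tfrac13\}$, the set where $(0,1)$ is one is $\{x\in X: x_1\le x_2+\tfrac13\}$, and both sets have $\mu$-measure $0$. 4. There are a finite positive measure $\lambda$ on $X$ concentrated on the diagonal $x_1=x_2$, a Markov kernel $\kappa$ such that for each $x\in X$ the probability measure $\kappa_x$ is concentrated on $X$ and has centre of mass $x$, where for $\lambda$-almost every $x$ it is concentrated on the line $y_1+y_2=x_1+x_2$, and a finite positive measure $\gamma$ on $X\times X$, such that the mean-preserving spread $\mu'=\mu-\lambda+\int\kappa_x\,d\lambda(x)$ of $\mu$ satisfies $\mu'\succeq_{X,S}\mu$, the marginals of $\gamma$ satisfy $\gamma_1-\gamma_2=\mu'$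 (so $\gamma_1-\gamma_2\succeq_{X,S}\mu$), $\ell_S(x,y)=u^*(x)-u^*(y)$ for $\gamma$-almost all $(x,y)$, and $\int\ell_S\,d\gamma=\int u^*\,d\mu$. Moreover $\int\ell_S\,d\gamma\le\int\ell_S\,d\gamma'$ for every finite positive measure $\gamma'$ on $X\times X$ with $\gamma'_1-\gamma'_2\succeq_{X,S}\mu$. -/

import Mathlib

open MeasureTheory ProbabilityTheory

namespace RestrictedAuction

/-! ### Mechanisms for a single buyer with `n` goods -/

/-- Type vectors and allocation vectors; type `x` values allocation `s` at `s ⬝ᵥ x`. -/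
abbrev Vec (n : ℕ) : Type := Fin n → ℝ

/-- A direct revelation mechanism: an allocation rule and a payment rule on reported types. -/
structure Mechanism (n : ℕ) where
  alloc : Vec n → Vec n
  pay : Vec n → ℝ

namespace Mechanism

variable {n : ℕ}

/-- Utility of a truthful buyer of type `x`. -/
def utility (M : Mechanism n) (x : Vec n) : ℝ := M.alloc x ⬝ᵥ x - M.pay x

/-- Every allocation made to a type in `X` lies in `S`. -/
def UsesAllocations (M : Mechanism n) (X S : Set (Vec n)) : Prop := ∀ x ∈ X, M.alloc x ∈ S

/-- Truthful reporting is optimal for every type in `X`. -/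
def IncentiveCompatible (M : Mechanism n) (X : Set (Vec n)) : Prop :=
  ∀ x ∈ X, ∀ y ∈ X, M.alloc y ⬝ᵥ x - M.pay y ≤ M.utility x

/-- Every type in `X` has nonnegative utility. -/
def IndividuallyRational (M : Mechanism n) (X : Set (Vec n)) : Prop := ∀ x ∈ X, 0 ≤ M.utility x

/-- A truthful and individually rational mechanism on `X` with allocations in `S`. -/
def IsAdmissible (M : Mechanism n) (X S : Set (Vec n)) : Prop :=
  M.UsesAllocations X S ∧ M.IncentiveCompatible X ∧ M.IndividuallyRational X

/-- Expected revenue when types are drawn from `F`. -/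
noncomputable def revenue (M : Mechanism n) (F : Measure (Vec n)) : ℝ := ∫ x, M.pay x ∂F

/-- `M` is admissible and no admissible mechanism has larger expected revenue; all the
expectations that are compared are expectations of integrable payments. -/
def IsOptimal (M : Mechanism n) (X S : Set (Vec n)) (F : Measure (Vec n)) : Prop :=
  M.IsAdmissible X S ∧ Integrable M.pay F ∧
    ∀ M' : Mechanism n, M'.IsAdmissible X S →
      Integrable M'.pay F ∧ M'.revenue F ≤ M.revenue F

/-- `M` offers the menu `menu` of (allocation, price) pairs: every type in `X` receives a pair of
the menu that it likes best (ties are broken in any way). -/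
def OffersMenu (M : Mechanism n) (X : Set (Vec n)) (menu : Set (Vec n × ℝ)) : Prop :=
  ∀ x ∈ X, (M.alloc x, M.pay x) ∈ menu ∧ ∀ o ∈ menu, o.1 ⬝ᵥ x - o.2 ≤ M.utility x

end Mechanism

/-! ### Consumer surplus functions, the order they induce, and the dual problem -/

section Duality

variable {n : ℕ}

/-- `s` is a subgradient at `x` of `u`, viewed as a function on `X`. -/
def IsSubgradient (X : Set (Vec n)) (u : Vec n → ℝ) (x s : Vec n) : Prop :=
  ∀ y ∈ X, u x + s ⬝ᵥ (y - x) ≤ u y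

/-- `U(X,S)`: convex functions on `X` having at each point of `X` a subgradient in `S`. -/
def surplusFunctions (X S : Set (Vec n)) : Set (Vec n → ℝ) :=
  {u | ConvexOn ℝ X u ∧ ∀ x ∈ X, ∃ s ∈ S, IsSubgradient X u x s}

/-- `ℓ_S(x,y) = sup_{s ∈ S} s · (x - y)`. -/
noncomputable def ell (S : Set (Vec n)) (x y : Vec n) : ℝ := ⨆ s : S, (s : Vec n) ⬝ᵥ (x - y)

/-- The types in `X` at which `s` is a subgradient of `u`. -/
def cell (X : Set (Vec n)) (u : Vec n → ℝ) (s : Vec n) : Set (Vec n) :=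
  {x | x ∈ X ∧ IsSubgradient X u x s}

/-- The order `μ' ⪰_{X,S} μ`: `∫ u dμ' ≥ ∫ u dμ` for all `u ∈ U(X,S)`. -/
def Dominates (X S : Set (Vec n)) (μ' μ : SignedMeasure (Vec n)) : Prop :=
  ∀ u ∈ surplusFunctions X S, ∫ᵛ x, u x ∂<•μ ≤ ∫ᵛ x, u x ∂<•μ'

/-- The difference `γ₁ - γ₂` of the two marginals of `γ`. -/
noncomputable def marginalDiff (γ : FiniteMeasure (Vec n × Vec n)) : SignedMeasure (Vec n) :=
  (γ : Measure (Vec n × Vec n)).fst.toSignedMeasure -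
    (γ : Measure (Vec n × Vec n)).snd.toSignedMeasure

/-- Feasible dual variables: positive measures `γ` supported within `X × X` whose marginals
satisfy `γ₁ - γ₂ ⪰_{X,S} μ`. -/
def IsDualFeasible (X S : Set (Vec n)) (μ : SignedMeasure (Vec n))
    (γ : FiniteMeasure (Vec n × Vec n)) : Prop :=
  (γ : Measure (Vec n × Vec n)) (X ×ˢ X)ᶜ = 0 ∧ Dominates X S (marginalDiff γ) μ

/-- The dual objective `∫ ℓ_S dγ`. -/
noncomputable def dualValue (S : Set (Vec n)) (γ : FiniteMeasure (Vec n × Vec n)) : ℝ :=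
  ∫ z, ell S z.1 z.2 ∂(γ : Measure (Vec n × Vec n))

/-- `μ'` arises from `μ` by a mean-preserving spread within `X`: the positive mass `lam` is taken
away, and the mass at each point `x` is spread out according to a probability measure `κ x` on `X`
with centre of mass `x`. -/
def IsMeanPreservingSpread (X : Set (Vec n)) (lam : FiniteMeasure (Vec n))
    (κ : Kernel (Vec n) (Vec n)) [IsMarkovKernel κ] (μ μ' : SignedMeasure (Vec n)) : Prop :=
  (lam : Measure (Vec n)) Xᶜ = 0 ∧
  (∀ x ∈ X, κ x Xᶜ = 0 ∧ ∀ i, Integrable (fun y => y i) (κ x) ∧ ∫ y, y i ∂(κ x) = x i) ∧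
  μ' = μ - (lam : Measure (Vec n)).toSignedMeasure +
    (κ ∘ₘ (lam : Measure (Vec n))).toSignedMeasure

end Duality

/-! ### Two i.i.d. uniform items, exactly one of which has to be allocated -/

/-- The type space `[0,1]²`. -/
def unitSquare : Set (Vec 2) := Set.Icc 0 1

/-- Two independent values, each uniform on `[0,1]`. -/
noncomputable def uniformTypes : Measure (Vec 2) :=
  Measure.pi fun _ => (volume : Measure ℝ).restrict (Set.Icc 0 1)

/-- `S = {(p₁,p₂) | 0 ≤ p₁, p₂ and p₁ + p₂ = 1}`. -/
def exactlyOne : Set (Vec 2) := {p | 0 ≤ p 0 ∧ 0 ≤ p 1 ∧ p 0 + p 1 = 1}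

/-- The transformed measure of the uniform density on the unit square: a point mass `+1` at the
origin, mass `+1` spread uniformly on each of the segments `(1,0)-(1,1)` and `(0,1)-(1,1)`, and
mass `-3` spread uniformly on the square. -/
noncomputable def transformedMeasure : SignedMeasure (Vec 2) :=
  (Measure.dirac (0 : Vec 2)).toSignedMeasure +
  (((volume : Measure ℝ).restrict (Set.Icc 0 1)).map fun t : ℝ => (![1, t] : Vec 2)).toSignedMeasure +
  (((volume : Measure ℝ).restrict (Set.Icc 0 1)).map fun t : ℝ => (![t, 1] : Vec 2)).toSignedMeasure -
  (3 : ℝ) • (Measure.pi fun _ : Fin 2 =>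
    (volume : Measure ℝ).restrict (Set.Icc 0 1)).toSignedMeasure

/-- Item 1 alone at price `1/3`, or item 2 alone for free. -/
noncomputable def optimalMenu : Set (Vec 2 × ℝ) := {(![1, 0], 1 / 3), (![0, 1], 0)}

/-- The surplus function `u*(x) = max (x₁ - 1/3) x₂` of that menu. -/
noncomputable def optimalSurplus (x : Vec 2) : ℝ := max (x 0 - 1 / 3) (x 1)

end RestrictedAuction

namespace RestrictedAuction

/-! ### Subgradients in `exactlyOne` -/

/-! Revenue. Payments are `s·x - u`, and `s` is almost everywhere the gradient of `u`, so
integrating by parts along horizontal and vertical lines gives E[p] = ∫ u dμ - u(0)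
(`IsAdmissible.integrable_pay_and_revenue`). Each direction produces one edge measure and one copy
of -∫ u; the term -u in the payment gives the third. Since u(0) ≥ 0, revenue is at most the maximum
of ∫ u dμ over U(X,S). The allocation rule is not assumed measurable, but coordinates of an
allocation sum to 1, so utility has slope one along (1,1), and almost everywhere the allocation is a
monotone function of x₀ - x₁ (`IsAdmissible.pay_ae_eq`).

Duality. A subgradient at x gives u(x) - u(y) ≤ ℓ(x,y), hence ∫ u dμ ≤ ∫ u d(γ₁ - γ₂) ≤ ∫ ℓ dγ for
every feasible γ (`integral_le_dualValue`). It remains to exhibit a γ that makes both inequalities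
equalities for u*.

Certificate. The unit mass at the origin is matched with the centre of the square, along the
diagonal. A unit mass at the centre is spread over the antidiagonal segment |x₀ - x₁| ≤ 1/3, where
u* is linear, so ∫ u* does not change. The square, with density 3, is then cut into three pieces of
mass 1, carried onto the right edge, the top edge and the spread mass (`map_transport`). Every point
y moves within a cell of u*, either along (1,1) or so that the coordinate allocated in that cell
grows at least as much as the other; this is equality ℓ = u*(x) - u*(y) (`transport_spec`). -/

lemma dotProduct_two (s x : Vec 2) : s ⬝ᵥ x = s 0 * x 0 + s 1 * x 1 := by
  simp [dotProduct, Fin.sum_univ_two]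

lemma mem_unitSquare {x : Vec 2} :
    x ∈ unitSquare ↔ (0 ≤ x 0 ∧ x 0 ≤ 1) ∧ (0 ≤ x 1 ∧ x 1 ≤ 1) := by
  simp only [unitSquare, Set.mem_Icc, Pi.le_def, Fin.forall_fin_two, Pi.zero_apply, Pi.one_apply]
  tauto

lemma dotProduct_le_max {s : Vec 2} (hs : s ∈ exactlyOne) (x : Vec 2) :
    s ⬝ᵥ x ≤ max (x 0) (x 1) := by
  obtain ⟨h0, h1, h⟩ := hs
  rw [dotProduct_two]
  calc s 0 * x 0 + s 1 * x 1 ≤ s 0 * max (x 0) (x 1) + s 1 * max (x 0) (x 1) := by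
        gcongr
        · exact le_max_left _ _
        · exact le_max_right _ _
    _ = max (x 0) (x 1) := by rw [← add_mul, h, one_mul]

/-- A linear form on the simplex attains its supremum at a vertex. -/
lemma ell_exactlyOne (x y : Vec 2) :
    ell exactlyOne x y = max (x 0 - y 0) (x 1 - y 1) := by
  have hb : BddAbove (Set.range fun s : exactlyOne => (s : Vec 2) ⬝ᵥ (x - y)) :=
    ⟨_, by rintro _ ⟨s, rfl⟩; exact dotProduct_le_max s.2 _⟩
  have h10 : (![1, 0] : Vec 2) ∈ exactlyOne := by simp [exactlyOne]
  have h01 : (![0, 1] : Vec 2) ∈ exactlyOne := by simp [exactlyOne]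
  have : Nonempty exactlyOne := ⟨⟨_, h10⟩⟩
  refine le_antisymm (ciSup_le fun s => dotProduct_le_max s.2 _) (max_le ?_ ?_)
  · refine le_trans (le_of_eq ?_) (le_ciSup hb ⟨_, h10⟩)
    rw [dotProduct_two]
    simp
  · refine le_trans (le_of_eq ?_) (le_ciSup hb ⟨_, h01⟩)
    rw [dotProduct_two]
    simp

lemma continuous_ell : Continuous fun z : Vec 2 × Vec 2 => ell exactlyOne z.1 z.2 := by
  simp only [ell_exactlyOne]
  fun_prop

/-- Averaging the subgradient inequality at the convex combination makes the linear term vanish. -/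
lemma convexOn_of_subgradients {n : ℕ} {X : Set (Vec n)} (hX : Convex ℝ X) {u : Vec n → ℝ}
    (hu : ∀ x ∈ X, ∃ s, IsSubgradient X u x s) : ConvexOn ℝ X u := by
  refine ⟨hX, fun x hx y hy a b ha hb hab => ?_⟩
  obtain ⟨s, hs⟩ := hu _ (hX hx hy ha hb hab)
  have h1 := mul_le_mul_of_nonneg_left (hs x hx) ha
  have h2 := mul_le_mul_of_nonneg_left (hs y hy) hb
  simp only [dotProduct_sub, dotProduct_add, dotProduct_smul, smul_eq_mul] at h1 h2 ⊢
  obtain rfl : b = 1 - a := by linarith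
  nlinarith

lemma convex_unitSquare : Convex ℝ unitSquare := convex_Icc _ _

lemma isCompact_unitSquare : IsCompact unitSquare := isCompact_Icc

lemma measurableSet_unitSquare : MeasurableSet unitSquare := measurableSet_Icc

/-- A function on the square with subgradients in `S` everywhere is a surplus function. -/
lemma mem_surplusFunctions_of_subgradients {u : Vec 2 → ℝ}
    (hu : ∀ x ∈ unitSquare, ∃ s ∈ exactlyOne, IsSubgradient unitSquare u x s) :
    u ∈ surplusFunctions unitSquare exactlyOne :=
  ⟨convexOn_of_subgradients convex_unitSquare fun x hx => (hu x hx).imp fun _ h => h.2, hu⟩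

lemma sub_le_ell {u : Vec 2 → ℝ} (hu : u ∈ surplusFunctions unitSquare exactlyOne)
    {x y : Vec 2} (hx : x ∈ unitSquare) (hy : y ∈ unitSquare) :
    u x - u y ≤ ell exactlyOne x y := by
  obtain ⟨s, hs, h⟩ := hu.2 x hx
  have h1 := h y hy
  have h2 := dotProduct_le_max hs (x - y)
  rw [ell_exactlyOne]
  simp only [dotProduct_sub, Pi.sub_apply] at h1 h2
  linarith

/-- `sub_le_ell` makes u 1-Lipschitz for the sup norm, up to the boundary of the square. -/
lemma continuousOn_of_mem_surplusFunctions {u : Vec 2 → ℝ}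
    (hu : u ∈ surplusFunctions unitSquare exactlyOne) : ContinuousOn u unitSquare := by
  refine (LipschitzOnWith.of_le_add_mul (K := 1) fun x hx y hy => ?_).continuousOn
  have h := sub_le_ell hu hx hy
  rw [ell_exactlyOne] at h
  have h0 := dist_le_pi_dist x y 0
  have h1 := dist_le_pi_dist x y 1
  rw [Real.dist_eq] at h0 h1
  have : max (x 0 - y 0) (x 1 - y 1) ≤ dist x y :=
    max_le ((le_abs_self _).trans h0) ((le_abs_self _).trans h1)
  simp only [NNReal.coe_one, one_mul]
  linarith

/-- Surplus functions are arbitrary off the square, so integrability has to come from the measure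
being concentrated there. -/
lemma integrable_of_continuousOn {α : Type*} [TopologicalSpace α] [T2Space α]
    [MeasurableSpace α] [OpensMeasurableSpace α] [SecondCountableTopology α]
    {X : Set α} (hX : IsCompact X) {u : α → ℝ}
    (hu : ContinuousOn u X) {m : Measure α} [IsFiniteMeasure m] (hm : m Xᶜ = 0) :
    Integrable u m := by
  have h : m.restrict X = m :=
    Measure.restrict_eq_self_of_ae_mem (measure_eq_zero_iff_ae_notMem.1 hm |>.mono
      fun x hx => not_not.1 hx)
  rw [← h]
  exact hu.integrableOn_compact hX

/-! ### Weak duality -/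

section WeakDuality

variable (γ : FiniteMeasure (Vec 2 × Vec 2))

lemma fst_compl_eq_zero {X : Set (Vec 2)} (hX : MeasurableSet X)
    (hγ : (γ : Measure (Vec 2 × Vec 2)) (X ×ˢ X)ᶜ = 0) :
    (γ : Measure (Vec 2 × Vec 2)).fst Xᶜ = 0 := by
  rw [Measure.fst_apply hX.compl]
  refine measure_mono_null (fun z hz => ?_) hγ
  exact fun h => hz h.1

lemma snd_compl_eq_zero {X : Set (Vec 2)} (hX : MeasurableSet X)
    (hγ : (γ : Measure (Vec 2 × Vec 2)) (X ×ˢ X)ᶜ = 0) :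
    (γ : Measure (Vec 2 × Vec 2)).snd Xᶜ = 0 := by
  rw [Measure.snd_apply hX.compl]
  refine measure_mono_null (fun z hz => ?_) hγ
  exact fun h => hz h.2

lemma integral_marginalDiff {u : Vec 2 → ℝ} (hu : ContinuousOn u unitSquare)
    (hγ : (γ : Measure (Vec 2 × Vec 2)) (unitSquare ×ˢ unitSquare)ᶜ = 0) :
    Integrable (fun z : Vec 2 × Vec 2 => u z.1 - u z.2) (γ : Measure (Vec 2 × Vec 2)) ∧
    ∫ᵛ x, u x ∂<•(marginalDiff γ) =
      ∫ z, (u z.1 - u z.2) ∂(γ : Measure (Vec 2 × Vec 2)) := by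
  have i1 := integrable_of_continuousOn isCompact_unitSquare hu
    (fst_compl_eq_zero γ measurableSet_unitSquare hγ)
  have i2 := integrable_of_continuousOn isCompact_unitSquare hu
    (snd_compl_eq_zero γ measurableSet_unitSquare hγ)
  have j1 : Integrable (fun z : Vec 2 × Vec 2 => u z.1) (γ : Measure (Vec 2 × Vec 2)) :=
    i1.comp_measurable measurable_fst
  have j2 : Integrable (fun z : Vec 2 × Vec 2 => u z.2) (γ : Measure (Vec 2 × Vec 2)) :=
    i2.comp_measurable measurable_snd
  refine ⟨j1.sub j2, ?_⟩
  rw [marginalDiff, VectorMeasure.integral_sub_vectorMeasure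
    (by simpa [VectorMeasure.Integrable] using i1) (by simpa [VectorMeasure.Integrable] using i2),
    VectorMeasure.integral_toSignedMeasure, VectorMeasure.integral_toSignedMeasure,
    integral_sub j1 j2, Measure.fst, Measure.snd,
    integral_map measurable_fst.aemeasurable i1.1, integral_map measurable_snd.aemeasurable i2.1]

/-- The second half of weak duality: `sub_le_ell` integrated over γ. -/
lemma integral_marginalDiff_le {u : Vec 2 → ℝ} (hu : u ∈ surplusFunctions unitSquare exactlyOne)
    (hγ : (γ : Measure (Vec 2 × Vec 2)) (unitSquare ×ˢ unitSquare)ᶜ = 0) :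
    ∫ᵛ x, u x ∂<•(marginalDiff γ) ≤ dualValue exactlyOne γ := by
  obtain ⟨hi, h⟩ := integral_marginalDiff γ (continuousOn_of_mem_surplusFunctions hu) hγ
  rw [h, dualValue]
  refine integral_mono_ae hi (integrable_of_continuousOn
    (isCompact_unitSquare.prod isCompact_unitSquare) continuous_ell.continuousOn hγ) ?_
  filter_upwards [measure_eq_zero_iff_ae_notMem.1 hγ] with z hz
  have hz := not_not.1 hz
  exact sub_le_ell hu hz.1 hz.2

end WeakDuality

/-! ### The surplus of the menu -/

lemma continuous_optimalSurplus : Continuous optimalSurplus := by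
  unfold optimalSurplus
  fun_prop

lemma optimalSurplus_mem : optimalSurplus ∈ surplusFunctions unitSquare exactlyOne := by
  refine mem_surplusFunctions_of_subgradients fun x _ => ?_
  rcases le_total (x 1) (x 0 - 1 / 3) with h | h
  · refine ⟨![1, 0], by simp [exactlyOne], fun y _ => ?_⟩
    have := le_max_left (y 0 - 1 / 3) (y 1)
    simp only [optimalSurplus, max_eq_left h, dotProduct_two] at *
    simp
  · refine ⟨![0, 1], by simp [exactlyOne], fun y _ => ?_⟩
    have := le_max_right (y 0 - 1 / 3) (y 1)
    simp only [optimalSurplus, max_eq_right h, dotProduct_two] at *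
    simp

lemma cell_optimalSurplus_fst :
    cell unitSquare optimalSurplus ![1, 0] = {x | x ∈ unitSquare ∧ x 1 + 1 / 3 ≤ x 0} := by
  ext x
  refine and_congr_right fun hx => ⟨fun h => ?_, fun h y _ => ?_⟩
  -- Testing at (1,0), where u* = 2/3, forces u*(x) ≤ x₀ - 1/3.
  · have h1 := h ![1, 0] (by simp [mem_unitSquare])
    have h2 := le_max_right (x 0 - 1 / 3) (x 1)
    simp only [optimalSurplus, dotProduct_two] at h1
    norm_num at h1
    linarith
  · have := le_max_left (y 0 - 1 / 3) (y 1)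
    have h' : x 1 ≤ x 0 - 1 / 3 := by linarith
    simp only [optimalSurplus, max_eq_left h', dotProduct_two] at *
    simp

lemma cell_optimalSurplus_snd :
    cell unitSquare optimalSurplus ![0, 1] = {x | x ∈ unitSquare ∧ x 0 ≤ x 1 + 1 / 3} := by
  ext x
  refine and_congr_right fun hx => ⟨fun h => ?_, fun h y _ => ?_⟩
  -- Testing at the origin, where u* = 0, forces u*(x) ≤ x₁.
  · have h1 := h ![0, 0] (by simp [mem_unitSquare])
    have h2 := le_max_left (x 0 - 1 / 3) (x 1)
    simp only [optimalSurplus, dotProduct_two] at h1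
    norm_num at h1
    linarith
  · have := le_max_right (y 0 - 1 / 3) (y 1)
    have h' : x 0 - 1 / 3 ≤ x 1 := by linarith
    simp only [optimalSurplus, max_eq_right h', dotProduct_two] at *
    simp

/-! ### Integration against the uniform distribution -/

/-- The uniform distribution on `[0,1]`. -/
noncomputable def uniformValue : Measure ℝ := (volume : Measure ℝ).restrict (Set.Icc 0 1)

instance : IsProbabilityMeasure uniformValue := ⟨by simp [uniformValue]⟩

instance : NullSingletonClass uniformValue := by unfold uniformValue; infer_instance

instance : IsProbabilityMeasure uniformTypes := by
  change IsProbabilityMeasure (Measure.pi fun _ => uniformValue)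
  infer_instance

lemma uniformValue_eq_Ioo : uniformValue = volume.restrict (Set.Ioo 0 1) :=
  (Measure.restrict_congr_set Ioo_ae_eq_Icc).symm

lemma measurable_vec : Measurable fun p : ℝ × ℝ => (![p.1, p.2] : Vec 2) := by
  refine measurable_pi_lambda _ fun i => ?_
  fin_cases i
  · exact measurable_fst
  · exact measurable_snd

lemma measurable_vec_fst (a : ℝ) : Measurable fun t : ℝ => (![t, a] : Vec 2) :=
  measurable_vec.comp (measurable_id.prodMk measurable_const)

lemma measurable_vec_snd (a : ℝ) : Measurable fun t : ℝ => (![a, t] : Vec 2) :=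
  measurable_vec.comp (measurable_const.prodMk measurable_id)

lemma uniformTypes_eq_map :
    uniformTypes = (uniformValue.prod uniformValue).map fun p : ℝ × ℝ => (![p.1, p.2] : Vec 2) :=
  ((measurePreserving_piFinTwo (fun _ : Fin 2 => uniformValue)).symm _).map_eq.symm

lemma lintegral_uniformTypes {F : Vec 2 → ENNReal} (hF : Measurable F) :
    ∫⁻ x, F x ∂uniformTypes = ∫⁻ y, ∫⁻ x, F ![x, y] ∂uniformValue ∂uniformValue := by
  rw [uniformTypes_eq_map, lintegral_map hF measurable_vec]
  exact lintegral_prod_symm _ (hF.comp measurable_vec).aemeasurable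

lemma integrable_uniformTypes_iff {F : Vec 2 → ℝ} (hF : AEStronglyMeasurable F uniformTypes) :
    Integrable F uniformTypes ↔
      Integrable (fun p : ℝ × ℝ => F ![p.1, p.2]) (uniformValue.prod uniformValue) := by
  rw [uniformTypes_eq_map] at hF ⊢
  exact integrable_map_measure hF measurable_vec.aemeasurable

lemma integral_uniformTypes {F : Vec 2 → ℝ} (hF : Integrable F uniformTypes) :
    ∫ x, F x ∂uniformTypes = ∫ y, ∫ x, F ![x, y] ∂uniformValue ∂uniformValue := by
  have h := (integrable_uniformTypes_iff hF.1).1 hF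
  have hm := hF.1
  rw [uniformTypes_eq_map] at hm ⊢
  rw [integral_map measurable_vec.aemeasurable hm, integral_prod_symm _ h]

lemma integral_uniformTypes' {F : Vec 2 → ℝ} (hF : Integrable F uniformTypes) :
    ∫ x, F x ∂uniformTypes = ∫ x, ∫ y, F ![x, y] ∂uniformValue ∂uniformValue := by
  have h := (integrable_uniformTypes_iff hF.1).1 hF
  have hm := hF.1
  rw [uniformTypes_eq_map] at hm ⊢
  rw [integral_map measurable_vec.aemeasurable hm, integral_prod _ h]

/-- Exchanging the two coordinates. -/
def swapVec (x : Vec 2) : Vec 2 := ![x 1, x 0]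

lemma measurable_swapVec : Measurable swapVec :=
  measurable_vec.comp (f := fun x : Vec 2 => (x 1, x 0)) (by fun_prop)

lemma measurePreserving_swapVec : MeasurePreserving swapVec uniformTypes uniformTypes := by
  refine ⟨measurable_swapVec, ?_⟩
  conv_lhs => rw [uniformTypes_eq_map]
  rw [Measure.map_map measurable_swapVec measurable_vec, uniformTypes_eq_map]
  conv_rhs => rw [← Measure.prod_swap, Measure.map_map measurable_vec measurable_swap]
  rfl

lemma uniformTypes_compl_unitSquare : uniformTypes unitSquareᶜ = 0 := by
  rw [uniformTypes_eq_map, Measure.map_apply measurable_vec measurableSet_unitSquare.compl]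
  have h0 : uniformValue (Set.Icc 0 1)ᶜ = 0 := by
    rw [uniformValue, Measure.restrict_apply measurableSet_Icc.compl]
    simp
  refine measure_mono_null (t := (Set.Icc 0 1)ᶜ ×ˢ Set.univ ∪ Set.univ ×ˢ (Set.Icc 0 1)ᶜ)
    (fun p hp => ?_) ?_
  · by_contra h
    simp only [Set.mem_union, Set.mem_prod, Set.mem_univ, and_true, true_and, not_or,
      Set.mem_compl_iff, not_not, Set.mem_Icc] at h
    exact hp (mem_unitSquare.2 h)
  · rw [measure_union_null_iff, Measure.prod_prod, Measure.prod_prod, h0]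
    simp

lemma ae_mem_unitSquare : ∀ᵐ x ∂uniformTypes, x ∈ unitSquare :=
  (measure_eq_zero_iff_ae_notMem.1 uniformTypes_compl_unitSquare).mono fun _ h => not_not.1 h

/-- Lines of slope one carry no mass. -/
lemma ae_sub_notMem {C : Set ℝ} (hC : C.Countable) :
    ∀ᵐ x ∂uniformTypes, x 0 - x 1 ∉ C := by
  have hm : MeasurableSet {x : Vec 2 | x 0 - x 1 ∈ C} :=
    hC.measurableSet.preimage (by fun_prop : Measurable fun x : Vec 2 => x 0 - x 1)
  suffices h : uniformTypes {x : Vec 2 | x 0 - x 1 ∈ C} = 0 from measure_eq_zero_iff_ae_notMem.1 h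
  rw [← lintegral_indicator_one hm, lintegral_uniformTypes (measurable_one.indicator hm)]
  refine (lintegral_congr fun y => ?_).trans lintegral_zero
  have : (fun x : ℝ => {x : Vec 2 | x 0 - x 1 ∈ C}.indicator (1 : Vec 2 → ENNReal) ![x, y]) =
      ((fun x : ℝ => x - y) ⁻¹' C).indicator 1 := by
    rfl
  rw [this, lintegral_indicator_one (hC.measurableSet.preimage (by fun_prop))]
  exact (hC.preimage (sub_left_injective)).measure_zero _

/-! ### Integration against the transformed measure -/

/-- The uniform distribution on the segment from `(1,0)` to `(1,1)`. -/
noncomputable def rightEdge : Measure (Vec 2) := uniformValue.map fun t : ℝ => (![1, t] : Vec 2)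

/-- The uniform distribution on the segment from `(0,1)` to `(1,1)`. -/
noncomputable def topEdge : Measure (Vec 2) := uniformValue.map fun t : ℝ => (![t, 1] : Vec 2)

instance : IsProbabilityMeasure rightEdge :=
  Measure.isProbabilityMeasure_map (measurable_vec_snd 1).aemeasurable

instance : IsProbabilityMeasure topEdge :=
  Measure.isProbabilityMeasure_map (measurable_vec_fst 1).aemeasurable

lemma transformedMeasure_eq : transformedMeasure =
    (Measure.dirac (0 : Vec 2)).toSignedMeasure + rightEdge.toSignedMeasure +
      topEdge.toSignedMeasure - (3 : ℝ) • uniformTypes.toSignedMeasure := rfl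

lemma ae_uniformValue : ∀ᵐ t ∂uniformValue, 0 ≤ t ∧ t ≤ 1 :=
  ae_restrict_mem measurableSet_Icc

lemma rightEdge_compl_unitSquare : rightEdge unitSquareᶜ = 0 := by
  rw [rightEdge, Measure.map_apply (measurable_vec_snd 1) measurableSet_unitSquare.compl,
    measure_eq_zero_iff_ae_notMem]
  filter_upwards [ae_uniformValue] with t ht h
  exact h (mem_unitSquare.2 (by simpa using ht))

lemma topEdge_compl_unitSquare : topEdge unitSquareᶜ = 0 := by
  rw [topEdge, Measure.map_apply (measurable_vec_fst 1) measurableSet_unitSquare.compl,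
    measure_eq_zero_iff_ae_notMem]
  filter_upwards [ae_uniformValue] with t ht h
  exact h (mem_unitSquare.2 (by simpa using ht))

lemma zero_mem_unitSquare : (0 : Vec 2) ∈ unitSquare := by simp [mem_unitSquare]

lemma dirac_compl_unitSquare {x : Vec 2} (hx : x ∈ unitSquare) :
    Measure.dirac x unitSquareᶜ = 0 := by
  rw [Measure.dirac_apply' _ measurableSet_unitSquare.compl]
  simp [hx]

lemma integrable_unitSquare {u : Vec 2 → ℝ} (hu : ContinuousOn u unitSquare)
    {m : Measure (Vec 2)} [IsFiniteMeasure m] (hm : m unitSquareᶜ = 0) :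
    m.toSignedMeasure.Integrable u := by
  simpa [VectorMeasure.Integrable] using integrable_of_continuousOn isCompact_unitSquare hu hm

lemma integrable_transformedMeasure {u : Vec 2 → ℝ} (hu : ContinuousOn u unitSquare) :
    transformedMeasure.Integrable u := by
  rw [transformedMeasure_eq]
  exact (((integrable_unitSquare hu (dirac_compl_unitSquare zero_mem_unitSquare)).add_vectorMeasure
    (integrable_unitSquare hu rightEdge_compl_unitSquare)).add_vectorMeasure
    (integrable_unitSquare hu topEdge_compl_unitSquare)).sub_vectorMeasure
    ((integrable_unitSquare hu uniformTypes_compl_unitSquare).smul_vectorMeasure 3)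

lemma integral_transformedMeasure {u : Vec 2 → ℝ} (hu : ContinuousOn u unitSquare) :
    ∫ᵛ x, u x ∂<•transformedMeasure = u 0 + ∫ x, u x ∂rightEdge + ∫ x, u x ∂topEdge -
      3 * ∫ x, u x ∂uniformTypes := by
  have h0 := integrable_unitSquare hu (dirac_compl_unitSquare zero_mem_unitSquare)
  have h1 := integrable_unitSquare hu rightEdge_compl_unitSquare
  have h2 := integrable_unitSquare hu topEdge_compl_unitSquare
  have h3 := (integrable_unitSquare hu uniformTypes_compl_unitSquare).smul_vectorMeasure 3
  rw [transformedMeasure_eq, VectorMeasure.integral_sub_vectorMeasure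
    ((h0.add_vectorMeasure h1).add_vectorMeasure h2) h3,
    VectorMeasure.integral_add_vectorMeasure (h0.add_vectorMeasure h1) h2,
    VectorMeasure.integral_add_vectorMeasure h0 h1, VectorMeasure.integral_smul_vectorMeasure]
  simp only [VectorMeasure.integral_toSignedMeasure, integral_dirac, smul_eq_mul]

/-! ### The rearrangement of the square along its edges -/

lemma setLIntegral_Ioo_const_sub (f : ℝ → ENNReal) (a b c : ℝ) :
    ∫⁻ x in Set.Ioo a b, f (c - x) = ∫⁻ s in Set.Ioo (c - b) (c - a), f s := by
  rw [← lintegral_indicator measurableSet_Ioo, ← lintegral_indicator measurableSet_Ioo,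
    ← lintegral_sub_left_eq_self _ c]
  refine lintegral_congr fun x => ?_
  simp only [Set.indicator_apply, Set.mem_Ioo, sub_sub_cancel]
  congr 1
  exact propext ⟨fun h => ⟨by linarith, by linarith⟩, fun h => ⟨by linarith, by linarith⟩⟩

lemma setLIntegral_Ioo_sub_const (f : ℝ → ENNReal) (a b c : ℝ) :
    ∫⁻ x in Set.Ioo a b, f (x - c) = ∫⁻ s in Set.Ioo (a - c) (b - c), f s := by
  rw [← lintegral_indicator measurableSet_Ioo, ← lintegral_indicator measurableSet_Ioo,
    ← lintegral_sub_right_eq_self ((Set.Ioo (a - c) (b - c)).indicator f) c]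
  refine lintegral_congr fun x => ?_
  simp only [Set.indicator_apply, Set.mem_Ioo]
  congr 1
  exact propext ⟨fun h => ⟨by linarith, by linarith⟩, fun h => ⟨by linarith, by linarith⟩⟩

/-- The slices of the square at the heights `y` and `2/3 - y` fill up the unit interval. -/
lemma lintegral_slices (f : ℝ → ENNReal) :
    (∫⁻ y in Set.Ioc (0 : ℝ) (1 / 3), ∫⁻ s in Set.Ioo y 1, f s) +
      ∫⁻ y in Set.Ioo (1 / 3 : ℝ) 1, ∫⁻ s in Set.Ioo 0 (2 / 3 - y), f s =
    3⁻¹ * ∫⁻ s, f s ∂uniformValue := by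
  -- Monotonicity makes the inner integral measurable in t without any assumption on `f`.
  have hG : Monotone fun t : ℝ => ∫⁻ s in Set.Ioo 0 t, f s := fun a b h =>
    lintegral_mono_set (Set.Ioo_subset_Ioo_right h)
  -- The substitution t = 2/3 - y turns the range (1/3, 1) into (-1/3, 1/3), and the slices with t ≤
  -- 0 are empty.
  have h1 : ∫⁻ y in Set.Ioo (1 / 3 : ℝ) 1, ∫⁻ s in Set.Ioo 0 (2 / 3 - y), f s =
      ∫⁻ t in Set.Ioo (0 : ℝ) (1 / 3), ∫⁻ s in Set.Ioo 0 t, f s := by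
    rw [setLIntegral_Ioo_const_sub (fun t => ∫⁻ s in Set.Ioo 0 t, f s),
      ← Set.Ioc_union_Ioo_eq_Ioo (b := (0 : ℝ)) (by norm_num) (by norm_num),
      lintegral_union measurableSet_Ioo
        (Set.disjoint_left.2 fun x hx hx' => absurd hx.2 (not_le.2 hx'.1)),
      setLIntegral_congr_fun (g := fun _ => 0) measurableSet_Ioc, lintegral_zero, zero_add]
    · norm_num
    · intro t ht
      simp [Set.Ioo_eq_empty (not_lt.2 ht.2)]
  -- For each y in (0, 1/3) the slices (y, 1) and (0, y) now make up the unit interval, so the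
  -- integrand is constant.
  rw [h1, setLIntegral_congr Ioo_ae_eq_Ioc.symm, ← lintegral_add_right _ hG.measurable,
    setLIntegral_congr_fun (g := fun _ => ∫⁻ s, f s ∂uniformValue) measurableSet_Ioo,
    lintegral_const, Measure.restrict_apply_univ, Real.volume_Ioo, mul_comm]
  · congr 1
    rw [sub_zero, one_div, ENNReal.ofReal_inv_of_pos (by norm_num)]
    norm_num
  · intro y hy
    have hd : Disjoint (Set.Ioo y 1) (Set.Ioc 0 y) :=
      Set.disjoint_left.2 fun x hx hx' => absurd hx'.2 (not_le.2 hx.1)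
    simp only
    rw [setLIntegral_congr (Ioo_ae_eq_Ioc (a := (0 : ℝ)) (b := y)),
      ← lintegral_union measurableSet_Ioc hd, Set.union_comm,
      Set.Ioc_union_Ioo_eq_Ioo hy.1.le (hy.2.trans (by norm_num)), uniformValue_eq_Ioo]

/-- The part of the square that is matched with the mass spread from the centre. -/
def heldRegion : Set (Vec 2) := {y | 1 / 3 < y 0 ∧ 1 / 3 < y 1 ∧ |y 0 - y 1| ≤ 1 / 3}

/-- The part of the square that is matched with the right edge. -/
def rightRegion : Set (Vec 2) := {y | y 1 < y 0} \ heldRegion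

/-- The part of the square that is matched with the top edge. -/
def topRegion : Set (Vec 2) := {y | y 0 < y 1} \ heldRegion

/-- The position on the right edge with which a point of `rightRegion` is matched. -/
noncomputable def edgePosition (y : Vec 2) : ℝ :=
  if y 1 ≤ 1 / 3 then 1 + y 1 - y 0 else y 0 - (y 1 + 1 / 3)

lemma measurableSet_heldRegion : MeasurableSet heldRegion :=
  (measurableSet_lt measurable_const (measurable_pi_apply 0)).inter
    ((measurableSet_lt measurable_const (measurable_pi_apply 1)).inter
      (measurableSet_le (f := fun y : Vec 2 => |y 0 - y 1|) (by fun_prop) measurable_const))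

lemma measurableSet_rightRegion : MeasurableSet rightRegion :=
  (measurableSet_lt (measurable_pi_apply 1) (measurable_pi_apply 0)).diff measurableSet_heldRegion

lemma measurableSet_topRegion : MeasurableSet topRegion :=
  (measurableSet_lt (measurable_pi_apply 0) (measurable_pi_apply 1)).diff measurableSet_heldRegion

lemma measurable_edgePosition : Measurable edgePosition :=
  Measurable.ite (measurableSet_le (measurable_pi_apply 1) measurable_const)
    (by fun_prop) (by fun_prop)

/-- Cut `rightRegion` horizontally. At height y ≤ 1/3 the slice is (y, 1), and moving along (1,1)
carries it onto the edge positions (y, 1). At height y > 1/3 the slice is (y + 1/3, 1), translated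
to (0, 2/3 - y). `lintegral_slices` glues these together. -/
lemma lintegral_rightRegion {f : ℝ → ENNReal} (hf : Measurable f) :
    ∫⁻ y in rightRegion, f (edgePosition y) ∂uniformTypes = 3⁻¹ * ∫⁻ s, f s ∂uniformValue := by
  have hm : Measurable fun y => f (edgePosition y) := hf.comp measurable_edgePosition
  rw [← lintegral_indicator measurableSet_rightRegion,
    lintegral_uniformTypes (hm.indicator measurableSet_rightRegion), ← lintegral_slices]
  conv_lhs => enter [1]; rw [uniformValue_eq_Ioo]
  rw [← Set.Ioc_union_Ioo_eq_Ioo (a := (0 : ℝ)) (b := 1 / 3) (c := 1) (by norm_num) (by norm_num),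
    lintegral_union measurableSet_Ioo
      (Set.disjoint_left.2 fun x hx hx' => absurd hx.2 (not_le.2 hx'.1))]
  congr 1
  · refine setLIntegral_congr_fun measurableSet_Ioc fun y hy => ?_
    have h : ∀ x ∈ Set.Ioo (0 : ℝ) 1, rightRegion.indicator (fun y => f (edgePosition y)) ![x, y] =
        (Set.Ioo y 1).indicator (fun x => f (1 + y - x)) x := fun x hx => by
      have hm : (![x, y] : Vec 2) ∈ rightRegion ↔ x ∈ Set.Ioo y 1 := by
        simp [rightRegion, heldRegion, hx.2]
        intros; linarith [hy.2]
      have he : edgePosition ![x, y] = 1 + y - x := if_pos hy.2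
      by_cases h : x ∈ Set.Ioo y 1
      · exact (Set.indicator_of_mem (hm.2 h) _).trans ((congrArg f he).trans
          (Set.indicator_of_mem h fun x => f (1 + y - x)).symm)
      · exact (Set.indicator_of_notMem (mt hm.1 h) _).trans (Set.indicator_of_notMem h _).symm
    rw [uniformValue_eq_Ioo, setLIntegral_congr_fun measurableSet_Ioo h,
      setLIntegral_indicator measurableSet_Ioo,
      Set.inter_eq_left.2 (Set.Ioo_subset_Ioo_left hy.1.le), setLIntegral_Ioo_const_sub]
    congr 3 <;> ring
  · refine setLIntegral_congr_fun measurableSet_Ioo fun y hy => ?_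
    have h : ∀ x ∈ Set.Ioo (0 : ℝ) 1, rightRegion.indicator (fun y => f (edgePosition y)) ![x, y] =
        (Set.Ioo (y + 1 / 3) 1).indicator (fun x => f (x - (y + 1 / 3))) x := fun x hx => by
      have hm : (![x, y] : Vec 2) ∈ rightRegion ↔ x ∈ Set.Ioo (y + 1 / 3) 1 := by
        simp only [rightRegion, heldRegion, Set.mem_sdiff, Set.mem_ofPred_eq, Set.mem_Ioo, hx.2,
          and_true, abs_le]
        simp only [Matrix.cons_val_zero, Matrix.cons_val_one]
        constructor
        · rintro ⟨h1, h2⟩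
          by_contra h3
          exact h2 ⟨by linarith [hy.1], hy.1, by linarith, by linarith⟩
        · exact fun h1 => ⟨by linarith, fun h2 => by linarith [h2.2.2.2]⟩
      have he : edgePosition ![x, y] = x - (y + 1 / 3) := if_neg (not_le.2 hy.1)
      by_cases h : x ∈ Set.Ioo (y + 1 / 3) 1
      · exact (Set.indicator_of_mem (hm.2 h) _).trans ((congrArg f he).trans
          (Set.indicator_of_mem h fun x => f (x - (y + 1 / 3))).symm)
      · exact (Set.indicator_of_notMem (mt hm.1 h) _).trans (Set.indicator_of_notMem h _).symm
    rw [uniformValue_eq_Ioo, setLIntegral_congr_fun measurableSet_Ioo h,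
      setLIntegral_indicator measurableSet_Ioo,
      Set.inter_eq_left.2 (Set.Ioo_subset_Ioo_left (by linarith [hy.1])),
      setLIntegral_Ioo_sub_const]
    congr 3 <;> ring

lemma measurable_edgePosition_right : Measurable fun y => (![1, edgePosition y] : Vec 2) :=
  (measurable_vec_snd 1).comp measurable_edgePosition

lemma measurable_edgePosition_top : Measurable fun y => (![edgePosition (swapVec y), 1] : Vec 2) :=
  (measurable_vec_fst 1).comp (measurable_edgePosition.comp measurable_swapVec)

lemma three_smul_inv (x : ENNReal) : 3 * (3⁻¹ * x) = x := by
  rw [← mul_assoc, ENNReal.mul_inv_cancel (by norm_num) (by norm_num), one_mul]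

lemma map_rightRegion :
    ((3 : NNReal) • uniformTypes.restrict rightRegion).map 
      (fun y => (![1, edgePosition y] : Vec 2)) = rightEdge := by
  refine Measure.ext_of_lintegral _ fun f hf => ?_
  rw [lintegral_map hf measurable_edgePosition_right, rightEdge,
    lintegral_map hf (measurable_vec_snd 1), lintegral_smul_measure,
    lintegral_rightRegion (f := fun s => f ![1, s]) (hf.comp (measurable_vec_snd 1)),
    ENNReal.smul_def, smul_eq_mul]
  exact three_smul_inv _

/-- Mirror image of `map_rightRegion` under `swapVec`, which preserves the uniform distribution. -/
lemma map_topRegion :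
    ((3 : NNReal) • uniformTypes.restrict topRegion).map
      (fun y => (![edgePosition (swapVec y), 1] : Vec 2)) = topEdge := by
  have h : swapVec ⁻¹' rightRegion = topRegion := by
    ext y
    simp only [swapVec, rightRegion, topRegion, heldRegion, Set.mem_preimage, Set.mem_sdiff,
      Set.mem_ofPred_eq, Matrix.cons_val_zero, Matrix.cons_val_one, abs_sub_comm (y 1) (y 0)]
    tauto
  refine Measure.ext_of_lintegral _ fun f hf => ?_
  have hg : Measurable fun y => f ![edgePosition y, 1] :=
    hf.comp ((measurable_vec_fst 1).comp measurable_edgePosition)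
  rw [lintegral_map hf measurable_edgePosition_top, topEdge,
    lintegral_map hf (measurable_vec_fst 1), lintegral_smul_measure, ← h,
    measurePreserving_swapVec.setLIntegral_comp_preimage measurableSet_rightRegion hg,
    lintegral_rightRegion (f := fun s => f ![s, 1]) (hf.comp (measurable_vec_fst 1)),
    ENNReal.smul_def, smul_eq_mul]
  exact three_smul_inv _

/-! ### The spread of the mass at the centre -/

/-- The centre of the square. -/
noncomputable def center : Vec 2 := ![1 / 2, 1 / 2]

/-- The point of the line `x₀ + x₁ = 1` on the same line of slope one as `y`. -/
noncomputable def toAntidiagonal (y : Vec 2) : Vec 2 :=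
  ![(1 + (y 0 - y 1)) / 2, (1 - (y 0 - y 1)) / 2]

lemma measurable_toAntidiagonal : Measurable toAntidiagonal :=
  measurable_vec.comp (f := fun y : Vec 2 => ((1 + (y 0 - y 1)) / 2, (1 - (y 0 - y 1)) / 2))
    (by fun_prop)

/-- The distribution over which the mass at the centre is spread. -/
noncomputable def spread : Measure (Vec 2) :=
  ((3 : NNReal) • uniformTypes.restrict heldRegion).map toAntidiagonal

open scoped Classical in
/-- The positive mass with which the (negative) mass at a point of the square is matched. -/
noncomputable def transport (y : Vec 2) : Vec 2 :=
  if y ∈ heldRegion then toAntidiagonal y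
  else if y 1 ≤ y 0 then ![1, edgePosition y] else ![edgePosition (swapVec y), 1]

lemma measurable_transport : Measurable transport :=
  Measurable.ite measurableSet_heldRegion measurable_toAntidiagonal
    (Measurable.ite (measurableSet_le (measurable_pi_apply 1) (measurable_pi_apply 0))
      measurable_edgePosition_right measurable_edgePosition_top)

lemma uniformTypes_eq_add : uniformTypes = uniformTypes.restrict rightRegion +
    uniformTypes.restrict topRegion + uniformTypes.restrict heldRegion := by
  have h1 : Disjoint rightRegion topRegion :=
    Set.disjoint_left.2 fun y h h' => lt_asymm (show y 1 < y 0 from h.1) h'.1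
  have h2 : Disjoint (rightRegion ∪ topRegion) heldRegion :=
    Set.disjoint_left.2 fun y h h' => h.elim (fun h => h.2 h') fun h => h.2 h'
  rw [← Measure.restrict_union h1 measurableSet_topRegion,
    ← Measure.restrict_union h2 measurableSet_heldRegion, Measure.restrict_eq_self_of_ae_mem]
  -- Only diagonal points outside `heldRegion` are missed, and the diagonal is null.
  filter_upwards [ae_sub_notMem (Set.countable_singleton 0)] with y hy
  by_cases h : y ∈ heldRegion
  · exact Or.inr h
  · rcases lt_trichotomy (y 0) (y 1) with h' | h' | h'
    · exact Or.inl (Or.inr ⟨h', h⟩)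
    · exact absurd (by simp [h']) hy
    · exact Or.inl (Or.inl ⟨h', h⟩)

lemma map_transport :
    ((3 : NNReal) • uniformTypes).map transport = rightEdge + topEdge + spread := by
  have h1 : (uniformTypes.restrict rightRegion).map transport =
      (uniformTypes.restrict rightRegion).map fun y => (![1, edgePosition y] : Vec 2) := by
    refine Measure.map_congr ((ae_restrict_mem measurableSet_rightRegion).mono fun y hy => ?_)
    rw [transport, if_neg hy.2, if_pos (show y 1 < y 0 from hy.1).le]
  have h2 : (uniformTypes.restrict topRegion).map transport =
      (uniformTypes.restrict topRegion).map
        fun y => (![edgePosition (swapVec y), 1] : Vec 2) := by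
    refine Measure.map_congr ((ae_restrict_mem measurableSet_topRegion).mono fun y hy => ?_)
    rw [transport, if_neg hy.2, if_neg (not_le.2 (show y 0 < y 1 from hy.1))]
  have h3 : (uniformTypes.restrict heldRegion).map transport =
      (uniformTypes.restrict heldRegion).map toAntidiagonal :=
    Measure.map_congr ((ae_restrict_mem measurableSet_heldRegion).mono fun y hy => if_pos hy)
  rw [← map_rightRegion, ← map_topRegion, spread]
  conv_lhs => rw [uniformTypes_eq_add]
  simp only [smul_add, Measure.map_add _ _ measurable_transport]
  simp only [Measure.map_smul]
  rw [h1, h2, h3]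

instance : IsProbabilityMeasure spread := by
  refine ⟨?_⟩
  have h := congrArg (fun m : Measure (Vec 2) => m Set.univ) map_transport
  simp only [Measure.map_apply measurable_transport MeasurableSet.univ, Measure.add_apply,
    Set.preimage_univ, Measure.smul_apply, measure_univ] at h
  -- The area of `heldRegion` is never computed: in `map_transport` the total mass is 3 and the two
  -- edges account for 2.
  rw [ENNReal.smul_def, smul_eq_mul, mul_one, one_add_one_eq_two,
    show ((3 : NNReal) : ENNReal) = 2 + 1 by norm_num] at h
  exact ((ENNReal.add_right_inj (by norm_num)).1 h).symm

lemma ae_spread : ∀ᵐ y ∂spread, y 0 + y 1 = 1 ∧ |y 0 - y 1| ≤ 1 / 3 := by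
  have hm : MeasurableSet {y : Vec 2 | y 0 + y 1 = 1 ∧ |y 0 - y 1| ≤ 1 / 3} :=
    (measurableSet_eq_fun (f := fun y : Vec 2 => y 0 + y 1) (by fun_prop) measurable_const).inter
      (measurableSet_le (f := fun y : Vec 2 => |y 0 - y 1|) (by fun_prop) measurable_const)
  refine (ae_map_iff measurable_toAntidiagonal.aemeasurable hm).2
    (Measure.ae_smul_measure ?_ (3 : NNReal))
  filter_upwards [ae_restrict_mem measurableSet_heldRegion] with y hy
  have h : (1 + (y 0 - y 1)) / 2 - (1 - (y 0 - y 1)) / 2 = y 0 - y 1 := by ring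
  simp only [toAntidiagonal, Matrix.cons_val_zero, Matrix.cons_val_one, h]
  exact ⟨by ring, hy.2.2⟩

lemma ae_spread_mem : ∀ᵐ y ∂spread, y ∈ unitSquare := by
  filter_upwards [ae_spread] with y hy
  have := abs_le.1 hy.2
  exact mem_unitSquare.2 ⟨⟨by linarith, by linarith⟩, ⟨by linarith, by linarith⟩⟩

lemma spread_compl_unitSquare : spread unitSquareᶜ = 0 :=
  measure_eq_zero_iff_ae_notMem.2 (ae_spread_mem.mono fun _ h => not_not.2 h)

lemma integrable_spread {u : Vec 2 → ℝ} (hu : ContinuousOn u unitSquare) :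
    Integrable u spread :=
  integrable_of_continuousOn isCompact_unitSquare hu spread_compl_unitSquare

lemma map_swapVec_spread : spread.map swapVec = spread := by
  have h : swapVec ⁻¹' heldRegion = heldRegion := by
    ext y
    simp only [swapVec, heldRegion, Set.mem_preimage,
      Set.mem_ofPred_eq, Matrix.cons_val_zero, Matrix.cons_val_one, abs_sub_comm (y 1) (y 0)]
    tauto
  have hs : (uniformTypes.restrict heldRegion).map swapVec = uniformTypes.restrict heldRegion := by
    conv_lhs => rw [← h]
    exact (measurePreserving_swapVec.restrict_preimage measurableSet_heldRegion).map_eq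
  have hc : swapVec ∘ toAntidiagonal = toAntidiagonal ∘ swapVec := by
    funext y
    simp only [Function.comp, swapVec, toAntidiagonal, Matrix.cons_val_zero, Matrix.cons_val_one]
    congr 2 <;> ring_nf
  rw [spread, Measure.map_map measurable_swapVec measurable_toAntidiagonal, hc,
    ← Measure.map_map measurable_toAntidiagonal measurable_swapVec, Measure.map_smul, hs]

/-- Symmetry under `swapVec` makes the two means equal, and they sum to 1 because the spread lies on
y₀ + y₁ = 1. -/
lemma integral_spread (i : Fin 2) : ∫ y, y i ∂spread = 1 / 2 := by
  have i0 : Integrable (fun y : Vec 2 => y 0) spread :=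
    integrable_spread (continuous_apply 0).continuousOn
  have i1 : Integrable (fun y : Vec 2 => y 1) spread :=
    integrable_spread (continuous_apply 1).continuousOn
  have h1 : ∫ y, y 0 ∂spread = ∫ y, y 1 ∂spread := by
    conv_lhs => rw [← map_swapVec_spread]
    rw [integral_map measurable_swapVec.aemeasurable
      (measurable_pi_apply 0).aestronglyMeasurable]
    rfl
  have h2 : ∫ y, y 0 ∂spread + ∫ y, y 1 ∂spread = 1 := by
    rw [← integral_add i0 i1, integral_congr_ae (ae_spread.mono fun y hy => hy.1)]
    simp
  fin_cases i <;> simp only [Fin.zero_eta, Fin.mk_one] <;> linarith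

lemma center_mem : center ∈ unitSquare := by
  rw [mem_unitSquare]
  norm_num [center]

/-- Jensen's inequality, from a subgradient at the centre, which is the mean of `spread`. -/
lemma le_integral_spread {u : Vec 2 → ℝ} (hu : u ∈ surplusFunctions unitSquare exactlyOne) :
    u center ≤ ∫ y, u y ∂spread := by
  obtain ⟨s, _, hs⟩ := hu.2 center center_mem
  have i (j : Fin 2) : Integrable (fun y : Vec 2 => s j * (y j - 1 / 2)) spread :=
    integrable_spread (by fun_prop)
  have hz (j : Fin 2) : ∫ y, s j * (y j - 1 / 2) ∂spread = 0 := by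
    rw [integral_const_mul, integral_sub (integrable_spread (continuous_apply j).continuousOn)
      (integrable_const _), integral_spread]
    simp
  have isum : Integrable (fun y : Vec 2 => s 0 * (y 0 - 1 / 2) + s 1 * (y 1 - 1 / 2)) spread :=
    (i 0).add (i 1)
  calc u center = ∫ y, (u center + (s 0 * (y 0 - 1 / 2) + s 1 * (y 1 - 1 / 2))) ∂spread := by
        rw [integral_add (integrable_const _) isum, integral_add (i 0) (i 1), hz, hz]
        simp
    _ ≤ ∫ y, u y ∂spread := by
        refine integral_mono_ae ((integrable_const _).add isum)
          (integrable_spread (continuousOn_of_mem_surplusFunctions hu)) ?_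
        filter_upwards [ae_spread_mem] with y hy
        have := hs y hy
        rw [dotProduct_two] at this
        simpa [center] using this

/-- Equality in Jensen: the support of `spread` lies in the cell of (0,1), where u* is linear. -/
lemma integral_optimalSurplus_spread :
    ∫ y, optimalSurplus y ∂spread = optimalSurplus center := by
  have h : ∀ᵐ y ∂spread, optimalSurplus y = y 1 := by
    filter_upwards [ae_spread] with y hy
    have := abs_le.1 hy.2
    exact max_eq_right (by linarith)
  rw [integral_congr_ae h, integral_spread]
  norm_num [optimalSurplus, center]

open scoped Classical in
/-- The spread of the centre; all other points stay in place. -/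
noncomputable def spreadKernel : Kernel (Vec 2) (Vec 2) :=
  Kernel.piecewise (measurableSet_singleton center) (Kernel.const _ spread) Kernel.id

instance : IsMarkovKernel spreadKernel := by
  unfold spreadKernel
  infer_instance

lemma spreadKernel_center : spreadKernel center = spread := by
  simp [spreadKernel, Kernel.piecewise_apply]

lemma spreadKernel_of_ne {x : Vec 2} (hx : x ≠ center) : spreadKernel x = Measure.dirac x := by
  simp [spreadKernel, Kernel.piecewise_apply, hx, Kernel.id_apply]

/-- The unit point mass at the centre. -/
noncomputable def centerMass : FiniteMeasure (Vec 2) := ⟨Measure.dirac center, inferInstance⟩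

lemma coe_centerMass : (centerMass : Measure (Vec 2)) = Measure.dirac center := rfl

/-- The transformed measure after the spread of mass at the centre. -/
noncomputable def spreadMeasure : SignedMeasure (Vec 2) :=
  transformedMeasure - (Measure.dirac center).toSignedMeasure + spread.toSignedMeasure

lemma isMeanPreservingSpread_spreadMeasure :
    IsMeanPreservingSpread unitSquare centerMass spreadKernel transformedMeasure spreadMeasure := by
  refine ⟨dirac_compl_unitSquare center_mem, fun x hx => ?_, ?_⟩
  · by_cases h : x = center
    · subst h
      rw [spreadKernel_center]
      refine ⟨spread_compl_unitSquare, fun i =>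
        ⟨integrable_spread (continuous_apply i).continuousOn, ?_⟩⟩
      rw [integral_spread]
      fin_cases i <;> simp [center]
    · rw [spreadKernel_of_ne h]
      exact ⟨dirac_compl_unitSquare hx, fun i => ⟨integrable_dirac (by simp), by simp⟩⟩
  · have h : spreadKernel ∘ₘ (centerMass : Measure (Vec 2)) = spread := by
      rw [coe_centerMass, Measure.dirac_bind spreadKernel.measurable, spreadKernel_center]
    simp only [h]
    rfl

lemma integral_spreadMeasure {u : Vec 2 → ℝ} (hu : ContinuousOn u unitSquare) :
    ∫ᵛ x, u x ∂<•spreadMeasure =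
      ∫ᵛ x, u x ∂<•transformedMeasure - u center + ∫ y, u y ∂spread := by
  have h0 := integrable_transformedMeasure hu
  have h1 := integrable_unitSquare hu (dirac_compl_unitSquare center_mem)
  rw [spreadMeasure, VectorMeasure.integral_add_vectorMeasure (h0.sub_vectorMeasure h1)
    (integrable_unitSquare hu spread_compl_unitSquare),
    VectorMeasure.integral_sub_vectorMeasure h0 h1]
  simp only [VectorMeasure.integral_toSignedMeasure, integral_dirac]

lemma dominates_spreadMeasure :
    Dominates unitSquare exactlyOne spreadMeasure transformedMeasure := fun u hu => by
  rw [integral_spreadMeasure (continuousOn_of_mem_surplusFunctions hu)]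
  linarith [le_integral_spread hu]

lemma integral_optimalSurplus_spreadMeasure :
    ∫ᵛ x, optimalSurplus x ∂<•spreadMeasure = ∫ᵛ x, optimalSurplus x ∂<•transformedMeasure := by
  rw [integral_spreadMeasure continuous_optimalSurplus.continuousOn,
    integral_optimalSurplus_spread]
  ring

/-! ### The optimal matching -/

/-- Each point `y` of the square is matched with `transport y`, and the origin with the centre. -/
noncomputable def matching : FiniteMeasure (Vec 2 × Vec 2) :=
  ⟨((3 : NNReal) • uniformTypes).map (fun y => (transport y, y)) + Measure.dirac (0, center),
    inferInstance⟩

lemma coe_matching : (matching : Measure (Vec 2 × Vec 2)) =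
    ((3 : NNReal) • uniformTypes).map (fun y => (transport y, y)) + Measure.dirac (0, center) :=
  rfl

lemma measurable_transport_prodMk : Measurable fun y => (transport y, y) :=
  measurable_transport.prodMk measurable_id

lemma ae_matching {P : Vec 2 × Vec 2 → Prop} (hP : MeasurableSet {z | P z})
    (h : ∀ y ∈ unitSquare, P (transport y, y)) (h0 : P (0, center)) :
    ∀ᵐ z ∂(matching : Measure (Vec 2 × Vec 2)), P z := by
  rw [coe_matching, ae_add_measure_iff]
  refine ⟨(ae_map_iff measurable_transport_prodMk.aemeasurable hP).2
    (Measure.ae_smul_measure ?_ (3 : NNReal)), (ae_dirac_iff hP).2 h0⟩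
  filter_upwards [ae_mem_unitSquare] with y hy using h y hy

/-- The first marginal carries the positive part and the spread mass, by `map_transport`; the second
carries 3 times the uniform distribution and the mass removed at the centre. -/
lemma marginalDiff_matching : marginalDiff matching = spreadMeasure := by
  have h1 : (matching : Measure (Vec 2 × Vec 2)).fst =
      rightEdge + topEdge + spread + Measure.dirac 0 := by
    rw [coe_matching, Measure.fst, Measure.map_add _ _ measurable_fst,
      Measure.map_map measurable_fst measurable_transport_prodMk,
      Measure.map_dirac' measurable_fst, ← map_transport]
    rfl
  have h2 : (matching : Measure (Vec 2 × Vec 2)).snd =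
      (3 : NNReal) • uniformTypes + Measure.dirac center := by
    rw [coe_matching, Measure.snd, Measure.map_add _ _ measurable_snd,
      Measure.map_map measurable_snd measurable_transport_prodMk,
      Measure.map_dirac' measurable_snd]
    congr 1
    exact Measure.map_id
  simp only [marginalDiff, h1, h2, spreadMeasure, transformedMeasure_eq,
    Measure.toSignedMeasure_add, Measure.toSignedMeasure_smul, NNReal.smul_def]
  simp only [NNReal.coe_ofNat]
  abel

/-- The points matched with each other lie in a common cell, in the direction that `ℓ` requires. -/
lemma transport_spec {y : Vec 2} (hy : y ∈ unitSquare) :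
    transport y ∈ unitSquare ∧
      ell exactlyOne (transport y) y = optimalSurplus (transport y) - optimalSurplus y := by
  obtain ⟨⟨h1, h2⟩, h3, h4⟩ := mem_unitSquare.1 hy
  rw [ell_exactlyOne, mem_unitSquare, optimalSurplus, optimalSurplus, transport]
  by_cases hh : y ∈ heldRegion
  -- The move is along (1,1) and |y₀ - y₁| ≤ 1/3, so u* is the second coordinate at both ends.
  · obtain ⟨h5, h6⟩ := abs_le.1 hh.2.2
    rw [if_pos hh]
    simp only [toAntidiagonal, Matrix.cons_val_zero, Matrix.cons_val_one]
    refine ⟨⟨⟨?_, ?_⟩, ?_, ?_⟩, ?_⟩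
    any_goals linarith
    rw [max_eq_right (a := y 0 - 1 / 3), max_eq_right (b := (1 - (y 0 - y 1)) / 2), max_eq_right]
    all_goals linarith
  · have hh' : 1 / 3 < y 0 → 1 / 3 < y 1 → |y 0 - y 1| ≤ 1 / 3 → False :=
      fun a b c => hh ⟨a, b, c⟩
    rw [if_neg hh]
    split_ifs with h5
    · rw [abs_of_nonneg (sub_nonneg.2 h5)] at hh'
      simp only [edgePosition, Matrix.cons_val_zero, Matrix.cons_val_one]
      -- For y₁ ≤ 1/3 the move is again along (1,1), so x₀ - x₁, and with it the cell, is unchanged.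
      by_cases h6 : y 1 ≤ 1 / 3
      · simp only [if_pos h6]
        refine ⟨⟨⟨?_, ?_⟩, ?_, ?_⟩, ?_⟩
        any_goals linarith
        simp only [max_def]
        split_ifs <;> linarith
      · simp only [if_neg h6]
        -- Here y lies in the cell of (1,0). Its image has difference 4/3 - (y₀ - y₁), which is at
        -- least y₀ - y₁ because y₁ > 1/3 gives y₀ - y₁ < 2/3; so the image is in the same cell and
        -- the first coordinate attains ℓ.
        have h7 : 1 / 3 < y 0 - y 1 := by
          by_contra h
          exact hh' (by linarith) (by linarith) (by linarith)
        refine ⟨⟨⟨?_, ?_⟩, ?_, ?_⟩, ?_⟩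
        any_goals linarith
        simp only [max_def]
        split_ifs <;> linarith
    · replace h5 := not_le.1 h5
      rw [abs_of_nonpos (by linarith)] at hh'
      by_cases h6 : y 0 ≤ 1 / 3
      · have he : edgePosition (swapVec y) = 1 + y 0 - y 1 := if_pos h6
        simp only [he, Matrix.cons_val_zero, Matrix.cons_val_one]
        refine ⟨⟨⟨?_, ?_⟩, ?_, ?_⟩, ?_⟩
        any_goals linarith
        simp only [max_def]
        split_ifs <;> linarith
      · have he : edgePosition (swapVec y) = y 1 - (y 0 + 1 / 3) := if_neg h6
        simp only [he, Matrix.cons_val_zero, Matrix.cons_val_one]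
        have h7 : 1 / 3 < y 1 - y 0 := by
          by_contra h
          exact hh' (by linarith) (by linarith) (by linarith)
        refine ⟨⟨⟨?_, ?_⟩, ?_, ?_⟩, ?_⟩
        any_goals linarith
        simp only [max_def]
        split_ifs <;> linarith

lemma isDualFeasible_matching :
    IsDualFeasible unitSquare exactlyOne transformedMeasure matching := by
  refine ⟨?_, marginalDiff_matching ▸ dominates_spreadMeasure⟩
  rw [measure_eq_zero_iff_ae_notMem]
  simp only [Set.mem_compl_iff, not_not]
  exact ae_matching (measurableSet_unitSquare.prod measurableSet_unitSquare)
    (fun y hy => ⟨(transport_spec hy).1, hy⟩) ⟨zero_mem_unitSquare, center_mem⟩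

lemma ell_ae_matching : ∀ᵐ z ∂(matching : Measure (Vec 2 × Vec 2)),
    ell exactlyOne z.1 z.2 = optimalSurplus z.1 - optimalSurplus z.2 := by
  refine ae_matching (measurableSet_eq_fun continuous_ell.measurable ?_)
    (fun y hy => (transport_spec hy).2) ?_
  · exact ((continuous_optimalSurplus.comp continuous_fst).sub
      (continuous_optimalSurplus.comp continuous_snd)).measurable
  · rw [ell_exactlyOne]
    norm_num [center, optimalSurplus]

/-- Complementary slackness: neither the spread nor the bound u*(x) - u*(y) ≤ ℓ(x,y) loses anything
for u*. -/
lemma dualValue_matching : dualValue exactlyOne matching =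
    ∫ᵛ x, optimalSurplus x ∂<•transformedMeasure := by
  rw [← integral_optimalSurplus_spreadMeasure, ← marginalDiff_matching,
    (integral_marginalDiff matching continuous_optimalSurplus.continuousOn
      isDualFeasible_matching.1).2, dualValue]
  exact integral_congr_ae ell_ae_matching

lemma integral_le_dualValue {u : Vec 2 → ℝ} (hu : u ∈ surplusFunctions unitSquare exactlyOne)
    {γ : FiniteMeasure (Vec 2 × Vec 2)}
    (hγ : IsDualFeasible unitSquare exactlyOne transformedMeasure γ) :
    ∫ᵛ x, u x ∂<•transformedMeasure ≤ dualValue exactlyOne γ :=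
  (hγ.2 u hu).trans (integral_marginalDiff_le γ hu hγ.1)

lemma integral_le_integral_optimalSurplus {u : Vec 2 → ℝ}
    (hu : u ∈ surplusFunctions unitSquare exactlyOne) :
    ∫ᵛ x, u x ∂<•transformedMeasure ≤ ∫ᵛ x, optimalSurplus x ∂<•transformedMeasure :=
  (integral_le_dualValue hu isDualFeasible_matching).trans_eq dualValue_matching

/-! ### Expected revenue -/

/-- Difference quotients lie between g(x) and g(y), and continuity of g at x closes the gap. -/
lemma hasDerivAt_of_slope_bounds {f g : ℝ → ℝ} {x : ℝ} (hg : ContinuousAt g x)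
    (h : ∀ᶠ y in nhds x, g x * (y - x) ≤ f y - f x ∧ f y - f x ≤ g y * (y - x)) :
    HasDerivAt f (g x) x := by
  rw [hasDerivAt_iff_isLittleO]
  have h1 : (fun y => f y - f x - (y - x) • g x) =O[nhds x]
      fun y => (g y - g x) * (y - x) := by
    refine Asymptotics.IsBigO.of_bound 1 (h.mono fun y hy => ?_)
    rw [one_mul, Real.norm_eq_abs, Real.norm_eq_abs, smul_eq_mul]
    refine abs_le_abs_of_nonneg ?_ ?_ <;> linarith [hy.1, hy.2]
  refine h1.trans_isLittleO ?_
  have h2 : (fun y => g y - g x) =o[nhds x] fun _ => (1 : ℝ) := by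
    rw [Asymptotics.isLittleO_one_iff]
    simpa using hg.tendsto.sub_const (g x)
  simpa using h2.mul_isBigO (Asymptotics.isBigO_refl (fun y => y - x) (nhds x))

/-! ### Subgradients and monotonicity of admissible allocations -/

namespace Mechanism

variable {M : Mechanism 2}

lemma IsAdmissible.isSubgradient (hM : M.IsAdmissible unitSquare exactlyOne) {x : Vec 2}
    (hx : x ∈ unitSquare) : IsSubgradient unitSquare M.utility x (M.alloc x) := fun y hy => by
  have := hM.2.1 y hy x hx
  rw [dotProduct_sub]
  unfold utility at *
  linarith

lemma IsAdmissible.utility_mem (hM : M.IsAdmissible unitSquare exactlyOne) :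
    M.utility ∈ surplusFunctions unitSquare exactlyOne :=
  mem_surplusFunctions_of_subgradients fun x hx => ⟨_, hM.1 x hx, hM.isSubgradient hx⟩

lemma IsAdmissible.continuousOn_utility (hM : M.IsAdmissible unitSquare exactlyOne) :
    ContinuousOn M.utility unitSquare :=
  continuousOn_of_mem_surplusFunctions hM.utility_mem

lemma IsAdmissible.alloc_one (hM : M.IsAdmissible unitSquare exactlyOne) {x : Vec 2}
    (hx : x ∈ unitSquare) : M.alloc x 1 = 1 - M.alloc x 0 := by
  linarith [(hM.1 x hx).2.2]

/-- The chance of receiving item 1 increases with the difference of the values. -/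
lemma IsAdmissible.alloc_le_alloc (hM : M.IsAdmissible unitSquare exactlyOne) {x y : Vec 2}
    (hx : x ∈ unitSquare) (hy : y ∈ unitSquare) (h : x 0 - x 1 < y 0 - y 1) :
    M.alloc x 0 ≤ M.alloc y 0 := by
  -- Adding the two subgradient inequalities gives (s(y) - s(x))·(y - x) ≥ 0. As coordinates sum to
  -- 1, this is the increment of the first allocation coordinate times the increment of x₀ - x₁.
  have h1 := hM.isSubgradient hx y hy
  have h2 := hM.isSubgradient hy x hx
  simp only [dotProduct_two, Pi.sub_apply, hM.alloc_one hx, hM.alloc_one hy] at h1 h2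
  by_contra! hlt
  nlinarith [mul_pos (sub_pos.2 hlt) (sub_pos.2 h)]

end Mechanism

/-- The point on the lower left boundary of the square whose coordinates have the difference
`z`, where `z` is first moved to the interval `[-1,1]`. -/
noncomputable def boundaryPoint (z : ℝ) : Vec 2 :=
  ![max (max (-1) (min 1 z)) 0, max (-max (-1) (min 1 z)) 0]

lemma boundaryPoint_mem (z : ℝ) : boundaryPoint z ∈ unitSquare := by
  have h1 : max (-1) (min 1 z) ≤ 1 := max_le (by norm_num) (min_le_left _ _)
  have h2 : -1 ≤ max (-1) (min 1 z) := le_max_left _ _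
  rw [mem_unitSquare]
  simp only [boundaryPoint, Matrix.cons_val_zero, Matrix.cons_val_one]
  refine ⟨⟨le_max_right _ _, max_le h1 zero_le_one⟩, le_max_right _ _, max_le ?_ zero_le_one⟩
  linarith

lemma boundaryPoint_sub (z : ℝ) :
    boundaryPoint z 0 - boundaryPoint z 1 = max (-1) (min 1 z) := by
  simp only [boundaryPoint, Matrix.cons_val_zero, Matrix.cons_val_one]
  generalize max (-1) (min 1 z) = c
  rcases le_total 0 c with h | h
  · rw [max_eq_left h, max_eq_right (by linarith)]
    ring
  · rw [max_eq_right h, max_eq_left (by linarith)]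
    ring

lemma boundaryPoint_of_mem {x : Vec 2} (hx : x ∈ unitSquare) (i : Fin 2) :
    boundaryPoint (x 0 - x 1) i = x i - min (x 0) (x 1) := by
  obtain ⟨⟨h1, h2⟩, h3, h4⟩ := mem_unitSquare.1 hx
  have h : max (-1) (min 1 (x 0 - x 1)) = x 0 - x 1 := by
    rw [min_eq_right (by linarith), max_eq_right (by linarith)]
  rcases le_total (x 0) (x 1) with h' | h' <;> fin_cases i <;>
    simp [boundaryPoint, h, h']

/-! ### The allocation as a monotone function of the difference of the values -/

namespace Mechanism

variable {M : Mechanism 2}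

/-- The chance of receiving item 1 at the boundary point with a given difference of the values. -/
noncomputable def boundaryAlloc (M : Mechanism 2) (z : ℝ) : ℝ := M.alloc (boundaryPoint z) 0

lemma IsAdmissible.boundaryAlloc_mem (hM : M.IsAdmissible unitSquare exactlyOne) (z : ℝ) :
    0 ≤ M.boundaryAlloc z ∧ M.boundaryAlloc z ≤ 1 := by
  obtain ⟨h1, h2, h3⟩ := hM.1 _ (boundaryPoint_mem z)
  exact ⟨h1, by unfold boundaryAlloc; linarith⟩

lemma IsAdmissible.monotone_boundaryAlloc (hM : M.IsAdmissible unitSquare exactlyOne) :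
    Monotone M.boundaryAlloc := fun a b hab => by
  have h : max (-1) (min 1 a) ≤ max (-1) (min 1 b) := by gcongr
  rcases h.lt_or_eq with h | h
  · exact hM.alloc_le_alloc (boundaryPoint_mem a) (boundaryPoint_mem b)
      (by rwa [boundaryPoint_sub, boundaryPoint_sub])
  · simp [boundaryAlloc, boundaryPoint, h]

/-- The allocation at the boundary point is a subgradient on the whole line of slope one. -/
lemma IsAdmissible.boundaryAlloc_slope (hM : M.IsAdmissible unitSquare exactlyOne) {x y : Vec 2}
    (hx : x ∈ unitSquare) (hy : y ∈ unitSquare) :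
    M.utility x + (M.boundaryAlloc (x 0 - x 1) * (y 0 - x 0) +
      (1 - M.boundaryAlloc (x 0 - x 1)) * (y 1 - x 1)) ≤ M.utility y := by
  have hb := boundaryPoint_mem (x 0 - x 1)
  -- The boundary point is x - min(x₀, x₁)·(1,1), and every allocation gives that displacement the
  -- same value, so the subgradient transfers from the boundary point to x.
  have h1 := hM.isSubgradient hx _ hb
  have h2 := hM.isSubgradient hb _ hy
  simp only [dotProduct_two, Pi.sub_apply, hM.alloc_one hx, hM.alloc_one hb,
    boundaryPoint_of_mem hx] at h1 h2
  unfold boundaryAlloc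
  linarith

/-- The differences of the values at which the allocation may depend on more than that. -/
def exceptionalSet (M : Mechanism 2) : Set ℝ := {z | ¬ContinuousAt M.boundaryAlloc z} ∪ {1, -1}

lemma IsAdmissible.countable_exceptionalSet (hM : M.IsAdmissible unitSquare exactlyOne) :
    M.exceptionalSet.Countable :=
  hM.monotone_boundaryAlloc.countable_not_continuousAt.union (Set.countable_insert.2 (by simp))

/-- Monotonicity compares only points with strictly different x₀ - x₁, so the value is squeezed
between one-sided limits, which agree at a continuity point. Differences ±1 are excluded because
clamping leaves no strictly larger or smaller difference there. -/
lemma IsAdmissible.alloc_eq_boundaryAlloc (hM : M.IsAdmissible unitSquare exactlyOne) {x : Vec 2}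
    (hx : x ∈ unitSquare) (h : x 0 - x 1 ∉ M.exceptionalSet) :
    M.alloc x 0 = M.boundaryAlloc (x 0 - x 1) := by
  simp only [exceptionalSet, Set.mem_union, Set.mem_ofPred_eq, not_or, not_not,
    Set.mem_insert_iff, Set.mem_singleton_iff] at h
  obtain ⟨hc, hn1, hn2⟩ := h
  obtain ⟨⟨h1, h2⟩, h3, h4⟩ := mem_unitSquare.1 hx
  have hlt : x 0 - x 1 < 1 := lt_of_le_of_ne (by linarith) hn1
  have hgt : -1 < x 0 - x 1 := lt_of_le_of_ne (by linarith) (Ne.symm hn2)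
  apply le_antisymm
  · refine ge_of_tendsto (hc.tendsto.mono_left (nhdsWithin_le_nhds (s := Set.Ioi (x 0 - x 1)))) ?_
    filter_upwards [self_mem_nhdsWithin] with z hz
    refine hM.alloc_le_alloc hx (boundaryPoint_mem z) ?_
    rw [boundaryPoint_sub]
    exact lt_max_of_lt_right (lt_min hlt hz)
  · refine le_of_tendsto (hc.tendsto.mono_left (nhdsWithin_le_nhds (s := Set.Iio (x 0 - x 1)))) ?_
    filter_upwards [self_mem_nhdsWithin] with z hz
    refine hM.alloc_le_alloc (boundaryPoint_mem z) hx ?_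
    rw [boundaryPoint_sub]
    exact max_lt hgt (min_lt_of_right_lt hz)

/-- Almost everywhere the payment is given by the utility and a monotone allocation. -/
lemma IsAdmissible.pay_ae_eq (hM : M.IsAdmissible unitSquare exactlyOne) :
    ∀ᵐ x ∂uniformTypes, M.pay x = M.boundaryAlloc (x 0 - x 1) * x 0 +
      (1 - M.boundaryAlloc (x 0 - x 1)) * x 1 - M.utility x := by
  filter_upwards [ae_mem_unitSquare, ae_sub_notMem hM.countable_exceptionalSet] with x hx h
  rw [← hM.alloc_eq_boundaryAlloc hx h, ← hM.alloc_one hx, ← dotProduct_two, utility]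
  ring

end Mechanism

/-! ### Integration by parts along coordinate lines -/

lemma integral_uniformValue (f : ℝ → ℝ) : ∫ t, f t ∂uniformValue = ∫ t in (0 : ℝ)..1, f t := by
  rw [intervalIntegral.integral_of_le zero_le_one, uniformValue,
    integral_Icc_eq_integral_Ioc]

/-- Integration by parts against the identity. -/
lemma integral_add_mul_deriv {f g : ℝ → ℝ} {C : Set ℝ} (hC : C.Countable)
    (hf : ContinuousOn f (Set.Icc 0 1)) (hg : IntervalIntegrable g volume 0 1)
    (h : ∀ x ∈ Set.Ioo (0 : ℝ) 1 \ C, HasDerivAt f (g x) x) :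
    ∫ x, (f x + x * g x) ∂uniformValue = f 1 := by
  rw [integral_uniformValue, integral_eq_of_hasDerivAt_off_countable_of_le (fun x => x * f x) _
    zero_le_one hC (continuousOn_id.mul hf) ?_ ?_]
  · simp
  · exact fun x hx => ((hasDerivAt_id' x).mul (h x hx)).congr_deriv (by rw [one_mul])
  · exact ((hf.mono (by simp)).intervalIntegrable).add (hg.continuousOn_mul continuousOn_id)

namespace Mechanism

variable {M : Mechanism 2}

lemma vec_mem_unitSquare {a b : ℝ} (ha : a ∈ Set.Icc (0 : ℝ) 1) (hb : b ∈ Set.Icc (0 : ℝ) 1) :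
    (![a, b] : Vec 2) ∈ unitSquare :=
  mem_unitSquare.2 ⟨ha, hb⟩

/-- `boundaryAlloc_slope`, applied from both ends of a horizontal segment, identifies the derivative
of the utility wherever `boundaryAlloc` is continuous, that is, off a countable set. -/
lemma IsAdmissible.integral_horizontal (hM : M.IsAdmissible unitSquare exactlyOne) {b : ℝ}
    (hb : b ∈ Set.Icc (0 : ℝ) 1) :
    ∫ t, (M.utility ![t, b] + t * M.boundaryAlloc (t - b)) ∂uniformValue =
      M.utility ![1, b] := by
  refine integral_add_mul_deriv (f := fun t => M.utility ![t, b])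
    (hM.countable_exceptionalSet.preimage (f := fun t => t - b) sub_left_injective) ?_ ?_ ?_
  · exact hM.continuousOn_utility.comp (by fun_prop) fun t ht => vec_mem_unitSquare ht hb
  · exact (hM.monotone_boundaryAlloc.comp fun s t h => sub_le_sub_right h b).intervalIntegrable
  · intro t ht
    have hc : ContinuousAt M.boundaryAlloc (t - b) := by
      by_contra h
      exact ht.2 (Or.inl h)
    refine hasDerivAt_of_slope_bounds (g := fun t => M.boundaryAlloc (t - b))
      (hc.comp (f := fun t => t - b) (by fun_prop)) ?_
    filter_upwards [Icc_mem_nhds ht.1.1 ht.1.2] with s hs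
    have hx := vec_mem_unitSquare (Set.Ioo_subset_Icc_self ht.1) hb
    have hy := vec_mem_unitSquare hs hb
    have h1 := hM.boundaryAlloc_slope hx hy
    have h2 := hM.boundaryAlloc_slope hy hx
    simp only [Matrix.cons_val_zero, Matrix.cons_val_one] at h1 h2
    exact ⟨by linarith, by linarith⟩

lemma IsAdmissible.integral_vertical (hM : M.IsAdmissible unitSquare exactlyOne) {a : ℝ}
    (ha : a ∈ Set.Icc (0 : ℝ) 1) :
    ∫ t, (M.utility ![a, t] + t * (1 - M.boundaryAlloc (a - t))) ∂uniformValue =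
      M.utility ![a, 1] := by
  refine integral_add_mul_deriv (f := fun t => M.utility ![a, t])
    (hM.countable_exceptionalSet.preimage (f := fun t => a - t) sub_right_injective) ?_ ?_ ?_
  · exact hM.continuousOn_utility.comp (by fun_prop) fun t ht => vec_mem_unitSquare ha ht
  · refine Monotone.intervalIntegrable fun s t h => ?_
    exact sub_le_sub_left (hM.monotone_boundaryAlloc (sub_le_sub_left h a)) 1
  · intro t ht
    have hc : ContinuousAt M.boundaryAlloc (a - t) := by
      by_contra h
      exact ht.2 (Or.inl h)
    refine hasDerivAt_of_slope_bounds (g := fun t => 1 - M.boundaryAlloc (a - t))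
      (continuousAt_const.sub (hc.comp (f := fun t => a - t) (by fun_prop))) ?_
    filter_upwards [Icc_mem_nhds ht.1.1 ht.1.2] with s hs
    have hx := vec_mem_unitSquare ha (Set.Ioo_subset_Icc_self ht.1)
    have hy := vec_mem_unitSquare ha hs
    have h1 := hM.boundaryAlloc_slope hx hy
    have h2 := hM.boundaryAlloc_slope hy hx
    simp only [Matrix.cons_val_zero, Matrix.cons_val_one] at h1 h2
    exact ⟨by linarith, by linarith⟩

/-- The expected payment of an admissible mechanism. -/
lemma IsAdmissible.integrable_pay_and_revenue (hM : M.IsAdmissible unitSquare exactlyOne) :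
    Integrable M.pay uniformTypes ∧
      M.revenue uniformTypes = ∫ᵛ x, M.utility x ∂<•transformedMeasure - M.utility 0 := by
  have iu : Integrable M.utility uniformTypes :=
    integrable_of_continuousOn isCompact_unitSquare hM.continuousOn_utility
      uniformTypes_compl_unitSquare
  have hd : Measurable fun x : Vec 2 => M.boundaryAlloc (x 0 - x 1) :=
    hM.monotone_boundaryAlloc.measurable.comp (by fun_prop : Measurable fun x : Vec 2 => x 0 - x 1)
  have i0 : Integrable (fun x : Vec 2 => x 0 * M.boundaryAlloc (x 0 - x 1)) uniformTypes := by
    refine Integrable.of_bound ((measurable_pi_apply 0).mul hd).aestronglyMeasurable 1 ?_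
    filter_upwards [ae_mem_unitSquare] with x hx
    obtain ⟨h1, h2⟩ := hM.boundaryAlloc_mem (x 0 - x 1)
    obtain ⟨h3, h4⟩ := (mem_unitSquare.1 hx).1
    rw [Real.norm_of_nonneg (by positivity)]
    exact mul_le_one₀ h4 h1 h2
  have i1 : Integrable (fun x : Vec 2 => x 1 * (1 - M.boundaryAlloc (x 0 - x 1)))
      uniformTypes := by
    refine Integrable.of_bound
      ((measurable_pi_apply 1).mul (measurable_const.sub hd)).aestronglyMeasurable 1 ?_
    filter_upwards [ae_mem_unitSquare] with x hx
    obtain ⟨h1, h2⟩ := hM.boundaryAlloc_mem (x 0 - x 1)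
    obtain ⟨h3, h4⟩ := (mem_unitSquare.1 hx).2
    rw [Real.norm_of_nonneg (mul_nonneg h3 (by linarith))]
    exact mul_le_one₀ h4 (by linarith) (by linarith)
  have s0 : Integrable (fun x => M.utility x + x 0 * M.boundaryAlloc (x 0 - x 1)) uniformTypes :=
    iu.add i0
  have s1 : Integrable (fun x => M.utility x + x 1 * (1 - M.boundaryAlloc (x 0 - x 1)))
    uniformTypes := iu.add i1
  have s2 : Integrable (fun x => x 0 * M.boundaryAlloc (x 0 - x 1) +
    x 1 * (1 - M.boundaryAlloc (x 0 - x 1))) uniformTypes := i0.add i1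
  -- Fubini, with the first coordinate integrated innermost; `e1` uses the opposite order.
  have e0 : ∫ x, (M.utility x + x 0 * M.boundaryAlloc (x 0 - x 1)) ∂uniformTypes =
      ∫ x, M.utility x ∂rightEdge := by
    rw [integral_uniformTypes s0, rightEdge, integral_map
      (measurable_vec_snd 1).aemeasurable (integrable_of_continuousOn isCompact_unitSquare
        hM.continuousOn_utility rightEdge_compl_unitSquare).1]
    exact integral_congr_ae (ae_uniformValue.mono fun b hb => hM.integral_horizontal hb)
  have e1 : ∫ x, (M.utility x + x 1 * (1 - M.boundaryAlloc (x 0 - x 1))) ∂uniformTypes =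
      ∫ x, M.utility x ∂topEdge := by
    rw [integral_uniformTypes' s1, topEdge, integral_map
      (measurable_vec_fst 1).aemeasurable (integrable_of_continuousOn isCompact_unitSquare
        hM.continuousOn_utility topEdge_compl_unitSquare).1]
    exact integral_congr_ae (ae_uniformValue.mono fun a ha => hM.integral_vertical ha)
  rw [integral_add iu i0] at e0
  rw [integral_add iu i1] at e1
  -- This also supplies the measurability of the payment, which is not part of admissibility.
  have hp : M.pay =ᵐ[uniformTypes] fun x => x 0 * M.boundaryAlloc (x 0 - x 1) +
      x 1 * (1 - M.boundaryAlloc (x 0 - x 1)) - M.utility x :=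
    hM.pay_ae_eq.mono fun x hx => by rw [hx]; ring
  refine ⟨(integrable_congr hp).2 (s2.sub iu), ?_⟩
  rw [integral_transformedMeasure hM.continuousOn_utility, revenue, integral_congr_ae hp,
    integral_sub s2 iu, integral_add i0 i1]
  linarith

/-! ### The menu -/

lemma exists_offersMenu : ∃ M : Mechanism 2, M.OffersMenu unitSquare optimalMenu := by
  classical
  refine ⟨⟨fun x => if x 1 ≤ x 0 - 1 / 3 then ![1, 0] else ![0, 1],
    fun x => if x 1 ≤ x 0 - 1 / 3 then 1 / 3 else 0⟩, fun x _ => ?_⟩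
  simp only [optimalMenu, utility]
  split_ifs with h
  · refine ⟨Or.inl rfl, ?_⟩
    rintro o (rfl | rfl) <;>
      simp only [dotProduct_two, Matrix.cons_val_zero, Matrix.cons_val_one] <;> linarith
  · refine ⟨Or.inr rfl, ?_⟩
    rintro o (rfl | rfl) <;>
      simp only [dotProduct_two, Matrix.cons_val_zero, Matrix.cons_val_one] <;> linarith

lemma OffersMenu.utility_eq (hM : M.OffersMenu unitSquare optimalMenu) {x : Vec 2}
    (hx : x ∈ unitSquare) : M.utility x = optimalSurplus x := by
  obtain ⟨h, ho⟩ := hM x hx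
  have h1 := ho (![1, 0], 1 / 3) (Or.inl rfl)
  have h2 := ho (![0, 1], 0) (Or.inr rfl)
  simp only [dotProduct_two, Matrix.cons_val_zero, Matrix.cons_val_one] at h1 h2
  refine le_antisymm ?_ (max_le (by linarith) (by linarith))
  rcases h with h | h <;> obtain ⟨ha, hp⟩ := Prod.ext_iff.1 h <;> simp only at ha hp <;>
    rw [utility, ha, hp, dotProduct_two] <;>
    simp only [Matrix.cons_val_zero, Matrix.cons_val_one]
  · exact le_trans (by linarith) (le_max_left _ _)
  · exact le_trans (by linarith) (le_max_right _ _)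

lemma OffersMenu.isAdmissible (hM : M.OffersMenu unitSquare optimalMenu) :
    M.IsAdmissible unitSquare exactlyOne := by
  refine ⟨fun x hx => ?_, fun x hx y hy => (hM x hx).2 _ (hM y hy).1, fun x hx => ?_⟩
  · rcases (hM x hx).1 with h | h <;> rw [show M.alloc x = _ from (Prod.ext_iff.1 h).1] <;> simp [exactlyOne]
  · rw [hM.utility_eq hx]
    exact (mem_unitSquare.1 hx).2.1.trans (le_max_right _ _)

lemma OffersMenu.revenue_eq (hM : M.OffersMenu unitSquare optimalMenu) :
    M.revenue uniformTypes = ∫ᵛ x, optimalSurplus x ∂<•transformedMeasure := by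
  have hc := hM.isAdmissible.continuousOn_utility
  have h {m : Measure (Vec 2)} (hm : m unitSquareᶜ = 0) :
      ∫ x, M.utility x ∂m = ∫ x, optimalSurplus x ∂m :=
    integral_congr_ae ((measure_eq_zero_iff_ae_notMem.1 hm).mono
      fun x hx => hM.utility_eq (not_not.1 hx))
  rw [hM.isAdmissible.integrable_pay_and_revenue.2, integral_transformedMeasure hc,
    integral_transformedMeasure continuous_optimalSurplus.continuousOn,
    h rightEdge_compl_unitSquare, h topEdge_compl_unitSquare, h uniformTypes_compl_unitSquare,
    hM.utility_eq zero_mem_unitSquare]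
  norm_num [optimalSurplus]

lemma OffersMenu.isOptimal (hM : M.OffersMenu unitSquare optimalMenu) :
    M.IsOptimal unitSquare exactlyOne uniformTypes := by
  refine ⟨hM.isAdmissible, hM.isAdmissible.integrable_pay_and_revenue.1, fun M' hM' => ?_⟩
  obtain ⟨h1, h2⟩ := hM'.integrable_pay_and_revenue
  refine ⟨h1, ?_⟩
  rw [h2, hM.revenue_eq]
  -- Individual rationality at the origin discards the term -u(0), which vanishes for u*.
  have := hM'.2.2 0 zero_mem_unitSquare
  linarith [integral_le_integral_optimalSurplus hM'.utility_mem]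

end Mechanism

/-! ### The masses of the cells -/

lemma transformedMeasure_apply {A : Set (Vec 2)} (hA : MeasurableSet A) :
    transformedMeasure A = (Measure.dirac (0 : Vec 2)).real A + rightEdge.real A + topEdge.real A -
      3 * uniformTypes.real A := by
  rw [transformedMeasure_eq]
  simp [Measure.toSignedMeasure_apply_measurable hA]

lemma uniformTypes_fst_cell : uniformTypes.real {x | x 1 + 1 / 3 ≤ x 0} = 2 / 9 := by
  have hm : MeasurableSet {x : Vec 2 | x 1 + 1 / 3 ≤ x 0} :=
    measurableSet_le (by fun_prop) (by fun_prop)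
  have h1 (y : ℝ) (hy : y ∈ Set.Icc (0 : ℝ) 1) :
      uniformValue (Set.Ici (y + 1 / 3)) = ENNReal.ofReal (2 / 3 - y) := by
    rw [uniformValue, Measure.restrict_apply measurableSet_Ici,
      show Set.Ici (y + 1 / 3) ∩ Set.Icc 0 1 = Set.Icc (y + 1 / 3) 1 by
        ext x
        simp only [Set.mem_inter_iff, Set.mem_Ici, Set.mem_Icc]
        exact ⟨fun h => ⟨h.1, h.2.2⟩, fun h => ⟨h.1, by linarith [hy.1], h.2⟩⟩,
      Real.volume_Icc]
    congr 1
    ring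
  have h2 : ∫ y in Set.Ioc (0 : ℝ) (2 / 3), (2 / 3 - y) = 2 / 9 := by
    rw [← intervalIntegral.integral_of_le (by norm_num), intervalIntegral.integral_sub
      (by simp) (by simp)]
    norm_num [integral_id]
  have h3 : ∀ y ∈ Set.Ioc (2 / 3 : ℝ) 1, ENNReal.ofReal (2 / 3 - y) = 0 := fun y hy =>
    ENNReal.ofReal_of_nonpos (by linarith [hy.1])
  have h4 : uniformTypes {x | x 1 + 1 / 3 ≤ x 0} = ENNReal.ofReal (2 / 9) := by
    rw [← lintegral_indicator_one hm, lintegral_uniformTypes (measurable_one.indicator hm)]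
    have (y : ℝ) : ∫⁻ x, {x : Vec 2 | x 1 + 1 / 3 ≤ x 0}.indicator (1 : Vec 2 → ENNReal)
        ![x, y] ∂uniformValue = uniformValue (Set.Ici (y + 1 / 3)) := by
      rw [← lintegral_indicator_one measurableSet_Ici]
      rfl
    simp only [this]
    rw [lintegral_congr_ae (ae_uniformValue.mono fun y hy => h1 y hy), uniformValue,
      setLIntegral_congr Ioc_ae_eq_Icc.symm,
      ← Set.Ioc_union_Ioc_eq_Ioc (a := (0 : ℝ)) (b := 2 / 3) (c := 1) (by norm_num) (by norm_num),
      lintegral_union measurableSet_Ioc (Set.disjoint_left.2 fun x hx hx' =>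
        absurd hx.2 (not_le.2 hx'.1)), setLIntegral_congr_fun measurableSet_Ioc h3,
      lintegral_zero, add_zero, ← ofReal_integral_eq_lintegral_ofReal, h2]
    · exact (continuous_const.sub continuous_id).integrableOn_Ioc
    · filter_upwards [ae_restrict_mem measurableSet_Ioc] with y hy
      simpa using hy.2
  rw [measureReal_def, h4, ENNReal.toReal_ofReal (by norm_num)]

lemma uniformTypes_snd_cell : uniformTypes.real {x | x 0 ≤ x 1 + 1 / 3} = 7 / 9 := by
  have hm : MeasurableSet {x : Vec 2 | x 1 + 1 / 3 ≤ x 0} :=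
    measurableSet_le (by fun_prop) (by fun_prop)
  have h : uniformTypes.real {x | x 0 ≤ x 1 + 1 / 3} =
      uniformTypes.real {x | x 1 + 1 / 3 ≤ x 0}ᶜ := by
    refine measureReal_congr ?_
    filter_upwards [ae_sub_notMem (Set.countable_singleton (1 / 3))] with x hx
    refine propext ⟨fun h h' => hx ?_, fun h => le_of_lt (lt_of_not_ge h)⟩
    have h1 : x 0 ≤ x 1 + 1 / 3 := h
    have h2 : x 1 + 1 / 3 ≤ x 0 := h'
    exact Set.mem_singleton_iff.2 (by linarith)
  rw [h, probReal_compl_eq_one_sub hm, uniformTypes_fst_cell]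
  norm_num

lemma uniformValue_Icc {a b : ℝ} (ha : 0 ≤ a) (hab : a ≤ b) (hb : b ≤ 1) :
    uniformValue.real (Set.Icc a b) = b - a := by
  rw [measureReal_def, uniformValue, Measure.restrict_apply measurableSet_Icc,
    Set.inter_eq_left.2 (Set.Icc_subset_Icc ha hb), Real.volume_Icc,
    ENNReal.toReal_ofReal (sub_nonneg.2 hab)]

lemma rightEdge_real {A : Set (Vec 2)} (hA : MeasurableSet A) {a b : ℝ} (ha : 0 ≤ a) (hab : a ≤ b)
    (hb : b ≤ 1) (h : ∀ t : ℝ, ![1, t] ∈ A ↔ t ∈ Set.Icc a b) : rightEdge.real A = b - a := by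
  rw [rightEdge, map_measureReal_apply (measurable_vec_snd 1) hA, ← uniformValue_Icc ha hab hb]
  congr 1
  exact Set.ext h

lemma topEdge_real {A : Set (Vec 2)} (hA : MeasurableSet A) {a b : ℝ} (ha : 0 ≤ a) (hab : a ≤ b)
    (hb : b ≤ 1) (h : ∀ t : ℝ, ![t, 1] ∈ A ↔ t ∈ Set.Icc a b) : topEdge.real A = b - a := by
  rw [topEdge, map_measureReal_apply (measurable_vec_fst 1) hA, ← uniformValue_Icc ha hab hb]
  congr 1
  exact Set.ext h

/-- The right edge contributes 2/3, and the triangle, of area 2/9, cancels it at density 3. -/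
lemma transformedMeasure_fst_cell :
    transformedMeasure {x | x ∈ unitSquare ∧ x 1 + 1 / 3 ≤ x 0} = 0 := by
  have hA : MeasurableSet {x : Vec 2 | x ∈ unitSquare ∧ x 1 + 1 / 3 ≤ x 0} :=
    measurableSet_unitSquare.inter
      (measurableSet_le (f := fun x : Vec 2 => x 1 + 1 / 3) (by fun_prop) (by fun_prop))
  have h0 : (Measure.dirac (0 : Vec 2)).real {x | x ∈ unitSquare ∧ x 1 + 1 / 3 ≤ x 0} = 0 := by
    rw [measureReal_def, Measure.dirac_apply' _ hA, Set.indicator_of_notMem]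
    · rfl
    · rintro ⟨_, h⟩
      norm_num at h
  have h1 : rightEdge.real {x | x ∈ unitSquare ∧ x 1 + 1 / 3 ≤ x 0} = 2 / 3 - 0 := by
    refine rightEdge_real hA le_rfl (by norm_num) (by norm_num) fun t => ?_
    simp only [Set.mem_ofPred_eq, mem_unitSquare, Matrix.cons_val_zero, Matrix.cons_val_one,
      Set.mem_Icc]
    exact ⟨fun h => ⟨h.1.2.1, by linarith [h.2]⟩,
      fun h => ⟨⟨by norm_num, h.1, by linarith [h.2]⟩, by linarith [h.2]⟩⟩
  have h2 : topEdge.real {x | x ∈ unitSquare ∧ x 1 + 1 / 3 ≤ x 0} = 0 := by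
    rw [topEdge, map_measureReal_apply (measurable_vec_fst 1) hA,
      show (fun t : ℝ => (![t, 1] : Vec 2)) ⁻¹' {x | x ∈ unitSquare ∧ x 1 + 1 / 3 ≤ x 0} = ∅ from
        Set.eq_empty_of_forall_notMem fun t ht => ?_, measureReal_empty]
    have h : (1 : ℝ) + 1 / 3 ≤ t := ht.2
    have h' : t ≤ 1 := (mem_unitSquare.1 ht.1).1.2
    linarith
  have h3 : uniformTypes.real {x | x ∈ unitSquare ∧ x 1 + 1 / 3 ≤ x 0} = 2 / 9 := by
    rw [← uniformTypes_fst_cell]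
    refine measureReal_congr (ae_mem_unitSquare.mono fun x hx => propext ⟨And.right, And.intro hx⟩)
  rw [transformedMeasure_apply hA, h0, h1, h2, h3]
  norm_num

/-- The balance is 1 (origin) + 1/3 (right edge) + 1 (top edge) - 3 · 7/9. -/
lemma transformedMeasure_snd_cell :
    transformedMeasure {x | x ∈ unitSquare ∧ x 0 ≤ x 1 + 1 / 3} = 0 := by
  have hA : MeasurableSet {x : Vec 2 | x ∈ unitSquare ∧ x 0 ≤ x 1 + 1 / 3} :=
    measurableSet_unitSquare.inter
      (measurableSet_le (g := fun x : Vec 2 => x 1 + 1 / 3) (by fun_prop) (by fun_prop))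
  have h0 : (Measure.dirac (0 : Vec 2)).real {x | x ∈ unitSquare ∧ x 0 ≤ x 1 + 1 / 3} = 1 := by
    rw [measureReal_def, Measure.dirac_apply' _ hA, Set.indicator_of_mem]
    · rfl
    · exact ⟨zero_mem_unitSquare, by norm_num⟩
  have h1 : rightEdge.real {x | x ∈ unitSquare ∧ x 0 ≤ x 1 + 1 / 3} = 1 - 2 / 3 := by
    refine rightEdge_real hA (by norm_num) (by norm_num) (by norm_num) fun t => ?_
    simp only [Set.mem_ofPred_eq, mem_unitSquare, Matrix.cons_val_zero, Matrix.cons_val_one,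
      Set.mem_Icc]
    exact ⟨fun h => ⟨by linarith [h.2], h.1.2.2⟩,
      fun h => ⟨⟨by norm_num, by linarith [h.1], h.2⟩, by linarith [h.1]⟩⟩
  have h2 : topEdge.real {x | x ∈ unitSquare ∧ x 0 ≤ x 1 + 1 / 3} = 1 - 0 := by
    refine topEdge_real hA le_rfl (by norm_num) (by norm_num) fun t => ?_
    simp only [Set.mem_ofPred_eq, mem_unitSquare, Matrix.cons_val_zero, Matrix.cons_val_one,
      Set.mem_Icc]
    exact ⟨fun h => h.1.1, fun h => ⟨⟨h, by norm_num⟩, by linarith [h.2]⟩⟩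
  have h3 : uniformTypes.real {x | x ∈ unitSquare ∧ x 0 ≤ x 1 + 1 / 3} = 7 / 9 := by
    rw [← uniformTypes_snd_cell]
    refine measureReal_congr (ae_mem_unitSquare.mono fun x hx => propext ⟨And.right, And.intro hx⟩)
  rw [transformedMeasure_apply hA, h0, h1, h2, h3]
  norm_num

lemma centerMass_ae : ∀ᵐ x ∂(centerMass : Measure (Vec 2)),
    x 0 = x 1 ∧ ∀ᵐ y ∂(spreadKernel x), y 0 + y 1 = x 0 + x 1 := by
  rw [coe_centerMass, ae_dirac_eq, Filter.eventually_pure, spreadKernel_center]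
  refine ⟨rfl, ae_spread.mono fun y hy => ?_⟩
  rw [hy.1]
  norm_num [center]

end RestrictedAuction

theorem mainTheorem8 :
    -- optimality of the menu, in terms of mechanisms and expected revenue
    (∃ M : RestrictedAuction.Mechanism 2,
      M.OffersMenu RestrictedAuction.unitSquare RestrictedAuction.optimalMenu) ∧
    (∀ M : RestrictedAuction.Mechanism 2,
      M.OffersMenu RestrictedAuction.unitSquare RestrictedAuction.optimalMenu →
        M.IsOptimal RestrictedAuction.unitSquare RestrictedAuction.exactlyOne
          RestrictedAuction.uniformTypes ∧
        (∀ x ∈ RestrictedAuction.unitSquare,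
          M.utility x = RestrictedAuction.optimalSurplus x) ∧
        M.revenue RestrictedAuction.uniformTypes =
          ∫ᵛ x, RestrictedAuction.optimalSurplus x ∂<•RestrictedAuction.transformedMeasure) ∧
    -- optimality of the surplus function in the primal problem
    RestrictedAuction.optimalSurplus ∈ RestrictedAuction.surplusFunctions
      RestrictedAuction.unitSquare RestrictedAuction.exactlyOne ∧
    (∀ u ∈ RestrictedAuction.surplusFunctions
        RestrictedAuction.unitSquare RestrictedAuction.exactlyOne,
      ∫ᵛ x, u x ∂<•RestrictedAuction.transformedMeasure ≤
        ∫ᵛ x, RestrictedAuction.optimalSurplus x ∂<•RestrictedAuction.transformedMeasure) ∧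
    -- the two cells, each of total mass zero
    RestrictedAuction.cell RestrictedAuction.unitSquare RestrictedAuction.optimalSurplus ![1, 0] =
      {x | x ∈ RestrictedAuction.unitSquare ∧ x 1 + 1 / 3 ≤ x 0} ∧
    RestrictedAuction.cell RestrictedAuction.unitSquare RestrictedAuction.optimalSurplus ![0, 1] =
      {x | x ∈ RestrictedAuction.unitSquare ∧ x 0 ≤ x 1 + 1 / 3} ∧
    RestrictedAuction.transformedMeasure
      (RestrictedAuction.cell RestrictedAuction.unitSquare
        RestrictedAuction.optimalSurplus ![1, 0]) = 0 ∧
    RestrictedAuction.transformedMeasure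
      (RestrictedAuction.cell RestrictedAuction.unitSquare
        RestrictedAuction.optimalSurplus ![0, 1]) = 0 ∧
    -- the dual certificate: a mean-preserving spread `μ'` of `μ` and a matching `γ` for `μ'`
    ∃ (lam : MeasureTheory.FiniteMeasure (RestrictedAuction.Vec 2))
      (κ : ProbabilityTheory.Kernel (RestrictedAuction.Vec 2) (RestrictedAuction.Vec 2))
      (_ : ProbabilityTheory.IsMarkovKernel κ)
      (μ' : MeasureTheory.SignedMeasure (RestrictedAuction.Vec 2))
      (γ : MeasureTheory.FiniteMeasure (RestrictedAuction.Vec 2 × RestrictedAuction.Vec 2)),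
      RestrictedAuction.IsMeanPreservingSpread RestrictedAuction.unitSquare lam κ
        RestrictedAuction.transformedMeasure μ' ∧
      -- mass on the diagonal is spread in the directions `(-1,1)` and `(1,-1)`
      (∀ᵐ x ∂(lam : MeasureTheory.Measure (RestrictedAuction.Vec 2)),
        x 0 = x 1 ∧ ∀ᵐ y ∂(κ x), y 0 + y 1 = x 0 + x 1) ∧
      RestrictedAuction.Dominates RestrictedAuction.unitSquare RestrictedAuction.exactlyOne
        μ' RestrictedAuction.transformedMeasure ∧
      RestrictedAuction.marginalDiff γ = μ' ∧
      RestrictedAuction.IsDualFeasible RestrictedAuction.unitSquare RestrictedAuction.exactlyOne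
        RestrictedAuction.transformedMeasure γ ∧
      -- `γ` respects `ℓ_S`
      (∀ᵐ z ∂(γ : MeasureTheory.Measure (RestrictedAuction.Vec 2 × RestrictedAuction.Vec 2)),
        RestrictedAuction.ell RestrictedAuction.exactlyOne z.1 z.2 =
          RestrictedAuction.optimalSurplus z.1 - RestrictedAuction.optimalSurplus z.2) ∧
      -- no duality gap, so that `γ` is optimal in the dual problem
      RestrictedAuction.dualValue RestrictedAuction.exactlyOne γ =
        ∫ᵛ x, RestrictedAuction.optimalSurplus x ∂<•RestrictedAuction.transformedMeasure ∧
      (∀ γ' : MeasureTheory.FiniteMeasure (RestrictedAuction.Vec 2 × RestrictedAuction.Vec 2),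
        RestrictedAuction.IsDualFeasible RestrictedAuction.unitSquare RestrictedAuction.exactlyOne
          RestrictedAuction.transformedMeasure γ' →
        RestrictedAuction.dualValue RestrictedAuction.exactlyOne γ ≤
          RestrictedAuction.dualValue RestrictedAuction.exactlyOne γ') := by
  open RestrictedAuction in
  exact ⟨Mechanism.exists_offersMenu,
    fun M hM => ⟨hM.isOptimal, fun x hx => hM.utility_eq hx, hM.revenue_eq⟩,
    optimalSurplus_mem, fun u hu => integral_le_integral_optimalSurplus hu,
    cell_optimalSurplus_fst, cell_optimalSurplus_snd,
    cell_optimalSurplus_fst ▸ transformedMeasure_fst_cell,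
    cell_optimalSurplus_snd ▸ transformedMeasure_snd_cell,
    centerMass, spreadKernel, inferInstance, spreadMeasure, matching,
    isMeanPreservingSpread_spreadMeasure, centerMass_ae, dominates_spreadMeasure,
    marginalDiff_matching, isDualFeasible_matching, ell_ae_matching, dualValue_matching,
    fun γ' hγ' => dualValue_matching.trans_le (integral_le_dualValue optimalSurplus_mem hγ')⟩
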